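/- Let $\mathbb D$ be the open unit disk of $\mathbb C$, $dA=\frac1\pi\,dx\,dy$ the normalized area measure on $\mathbb D$, and $\mathscr B$ the beta function. For real $a,b>-1$ put $$d\mu_{a,b}(z)=\frac{1}{\mathscr B(a+1,b+1)}\,|z|^{2b}(1-|z|^2)^a\,dA(z)\quad\text{on }\mathbb D.$$ For $\alpha,\beta>-1$ let $\beta_0$ be the unique number in $(-1,0]$ with $\beta-\beta_0\in\mathbb N=\{0,1,2,\dots\}$, and for $\xi\in\mathbb D$ set $$Q_{\alpha,\beta}(\xi)=\begin{cases}(\alpha+1)\,\mathscr B(\alpha+1,\beta+1)&\text{if }\beta\in\mathbb N,\\[4pt] \dfrac{\mathscr B(\alpha+1,\beta+1)}{\mathscr B(\alpha+1,\beta_0+1)}\displaystyle\sum_{n=0}^{\infty}\frac{\beta_0(-\xi)^n}{n+\beta_0}\binom{\alpha+1}{n}&\text{if }\beta\notin\mathbb N.\end{cases}$$ Let $\mathcal J_\alpha$ be the set of all $\beta\in(-1,0]$ such that $Q_{\alpha,\beta}$ has no zero in $\mathbb D$. **Theorem.** Let $-1<a,b,\alpha,\beta<+\infty$ with $\beta=\beta_0+m$,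 $m\in\mathbb N$ and $\beta_0\in\mathcal J_\alpha$. Define the integral operators $$Af(z)=\frac{1}{z^m}\int_{\mathbb D}\frac{f(w)\,Q_{\alpha,\beta}(z\overline w)\,(1-|w|^2)^{\alpha-a}\,w^m}{|w|^{2m+2b-2\beta}\,(1-z\overline w)^{2+\alpha}}\,d\mu_{a,b}(w),$$ $$Bf(z)=\frac{1}{|z|^m}\int_{\mathbb D}\frac{f(w)\,|Q_{\alpha,\beta}(z\overline w)|\,(1-|w|^2)^{\alpha-a}\,|w|^{2\beta-2b-m}}{|1-z\overline w|^{2+\alpha}}\,d\mu_{a,b}(w),$$ where $(1-z\overline w)^{2+\alpha}$ is the principal branch. Such an operator $T$ is called bounded on $L^p(\mathbb D,d\mu_{a,b})$ if there is a constant $C$ such that for every $f\in L^p(\mathbb D,d\mu_{a,b})$ the integral defining $Tf(z)$ converges absolutely for almost every $z$, and $Tf\in L^p(\mathbb D,d\mu_{a,b})$ with $\|Tf\|_p\le C\|f\|_p$. Then for $1\le p<+\infty$ the following assertions are equivalent: 1. $A$ is bounded on $L^p(\mathbb D,d\mu_{a,b})$. 2. $B$ is bounded on $L^p(\mathbb D,d\mu_{a,b})$.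 3. $p(\alpha+1)>a+1$ and $$\begin{cases} m-2<2b\le 2\beta-m&\text{if }p=1,\\ pm-2<2b<p(2\beta+2)-pm-2&\text{if }p>1.\end{cases}$$ -/

import Mathlib

open MeasureTheory
open scoped ENNReal NNReal ComplexConjugate

noncomputable section

namespace ModifiedBergman

/-- The measure `μ_{a,b}` on the unit disk `𝔻` (seen as a measure on `ℂ` carried by `𝔻`), i.e.
`dμ_{a,b}(z) = |z|^{2b} (1 - |z|²)^a dA(z) / 𝓑(a+1, b+1)`, where `dA = dx dy / π` is the
normalized area measure and `𝓑` is the beta function. -/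
def mu (a b : ℝ) : Measure ℂ :=
  (volume.restrict (Metric.ball (0 : ℂ) 1)).withDensity fun z =>
    ENNReal.ofReal (1 / Real.pi * (1 / ProbabilityTheory.beta (a + 1) (b + 1)) *
      ‖z‖ ^ (2 * b) * (1 - ‖z‖ ^ 2) ^ a)

/-- For `β > -1`, the unique `β₀ ∈ (-1, 0]` such that `β - β₀` is an integer. -/
def betaZero (β : ℝ) : ℝ := β - ⌈β⌉

theorem betaZero_add_natCast {β₀ : ℝ} (h : β₀ ∈ Set.Ioc (-1 : ℝ) 0) (m : ℕ) :
    betaZero (β₀ + m) = β₀ := by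
  have h0 : ⌈β₀⌉ = 0 := by
    rw [Int.ceil_eq_iff]
    push_cast
    exact ⟨by linarith [h.1], h.2⟩
  simp [betaZero, Int.ceil_add_natCast, h0]

open Classical in
/-- The function `Q_{α,β}`: the constant `(α+1) 𝓑(α+1, β+1)` if `β ∈ ℕ`, and otherwise
`𝓑(α+1, β+1) / 𝓑(α+1, β₀+1) * ∑_{n ≥ 0} β₀ (-ξ)^n / (n + β₀) * binom(α+1, n)`
with `β₀ = betaZero β`. -/
def Q (α β : ℝ) (ξ : ℂ) : ℂ :=
  if ∃ n : ℕ, β = n then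
    (((α + 1) * ProbabilityTheory.beta (α + 1) (β + 1) : ℝ) : ℂ)
  else
    ((ProbabilityTheory.beta (α + 1) (β + 1) /
        ProbabilityTheory.beta (α + 1) (betaZero β + 1) : ℝ) : ℂ) *
      ∑' n : ℕ, (betaZero β : ℂ) * (-ξ) ^ n / ((n : ℂ) + (betaZero β : ℂ)) *
        ((Ring.choose (α + 1) n : ℝ) : ℂ)

/-- The set `𝒥_α` of those `β ∈ (-1, 0]` for which `Q_{α,β}` has no zero in the unit disk. -/
def J (α : ℝ) : Set ℝ :=
  {β | β ∈ Set.Ioc (-1 : ℝ) 0 ∧ ∀ ξ ∈ Metric.ball (0 : ℂ) 1, Q α β ξ ≠ 0}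

/-- The integrand (in the variable `w`) of the operator `A`. -/
def integrandA (α β a b : ℝ) (m : ℕ) (f : ℂ → ℂ) (z w : ℂ) : ℂ :=
  f w * Q α β (z * conj w) * (((1 - ‖w‖ ^ 2) ^ (α - a) : ℝ) : ℂ) * w ^ m /
    (((‖w‖ ^ (2 * m + 2 * b - 2 * β) : ℝ) : ℂ) * (1 - z * conj w) ^ ((2 + α : ℝ) : ℂ))

/-- The operator `A`. -/
def opA (α β a b : ℝ) (m : ℕ) (f : ℂ → ℂ) (z : ℂ) : ℂ :=
  1 / z ^ m * ∫ w, integrandA α β a b m f z w ∂(mu a b)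

/-- The integrand (in the variable `w`) of the operator `B`. -/
def integrandB (α β a b : ℝ) (m : ℕ) (f : ℂ → ℂ) (z w : ℂ) : ℂ :=
  f w * ((‖Q α β (z * conj w)‖ * (1 - ‖w‖ ^ 2) ^ (α - a) * ‖w‖ ^ (2 * β - 2 * b - m) /
    ‖1 - z * conj w‖ ^ (2 + α) : ℝ) : ℂ)

/-- The operator `B`. -/
def opB (α β a b : ℝ) (m : ℕ) (f : ℂ → ℂ) (z : ℂ) : ℂ :=
  1 / ((‖z‖ ^ m : ℝ) : ℂ) * ∫ w, integrandB α β a b m f z w ∂(mu a b)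

/-- An integral operator `T`, whose value `T f z` is given by an integral with integrand
`w ↦ F f z w`, is bounded on `L^p(μ)`: for each `f ∈ L^p(μ)` the integral converges absolutely
for almost every `z`, and `T f ∈ L^p(μ)` with `‖T f‖_p ≤ C ‖f‖_p`, the constant `C` being
independent of `f`. -/
def IsBoundedOnLp (F : (ℂ → ℂ) → ℂ → ℂ → ℂ) (T : (ℂ → ℂ) → ℂ → ℂ) (p : ℝ≥0∞)
    (μ : Measure ℂ) : Prop :=
  ∃ C : ℝ≥0, ∀ f : ℂ → ℂ, MemLp f p μ →
    (∀ᵐ z ∂μ, Integrable (F f z) μ) ∧ MemLp (T f) p μ ∧ eLpNorm (T f) p μ ≤ C * eLpNorm f p μ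

end ModifiedBergman

end

/-! Only the moduli of the two kernels matter, and these coincide: with the prefactor included, both
are $|z|^{-m}|Q(z\bar w)|(1-|w|^2)^{\alpha-a}|w|^{2\beta-2b-m}/|1-z\bar w|^{2+\alpha}$.
`IsBergmanKernel` records this together with the little continuity needed at $z=0$ and $w=1$, and
`IsBergmanKernel.isBoundedOnLp_iff` treats $A$ and $B$ at once. Of $Q$ one needs continuity on the
closed disk, $Q(0)\ne0$ and $Q(1)\ne0$ (`Q_properties`).

Sufficiency: $Q$ is bounded, so a weighted Forelli–Rudin estimate (`forelli_rudin`) controls row and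
column integrals of the kernel. For $p=1$ uniformly bounded columns and Tonelli suffice; for $p>1$
the Schur test (`lintegral_schur`) runs with $h(z)=|z|^{-s}(1-|z|^2)^{-t}$, and the numerical
conditions are what make admissible $s,t$ exist.

Necessity: convergence of the integral at a single $z$ near $0$ already forces every $f\in L^p$ to
be integrable against $|w|^{2\beta-m}(1-|w|^2)^\alpha$. Radial test functions with a logarithmic
factor, concentrated at $0$ or at the unit circle, give the upper bound on $b$ and
$a+1<p(\alpha+1)$, except that $p=1$ still allows $\alpha=a$. The lower bound on $b$ holds because
some image behaves like $|z|^{-m}$ at $0$. The case $p=1$, $\alpha=a$ is excluded by letting unit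
masses concentrate at $w=1$: Fatou would make $z\mapsto\varphi(z)\kappa(z,1)$ integrable ($\varphi$
the prefactor, $\kappa$ the kernel), but since $Q(1)\ne0$ it is too singular at $z=1$. -/

namespace ModifiedBergman

/-! ### The binomial series and the function `Q` -/

theorem succ_mul_choose_succ (γ : ℝ) (n : ℕ) :
    ((n : ℝ) + 1) * Ring.choose γ (n + 1) = (γ - n) * Ring.choose γ n := by
  have h1 := Ring.descPochhammer_eq_factorial_smul_choose γ (n + 1)
  have h2 := Ring.descPochhammer_eq_factorial_smul_choose γ n
  rw [descPochhammer_succ_right, Polynomial.smeval_mul, h2, Nat.factorial_succ] at h1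
  have h3 : ((n.factorial : ℕ) : ℝ) ≠ 0 := by positivity
  simp [Polynomial.smeval_sub, Polynomial.smeval_X, Polynomial.smeval_natCast] at h1
  apply mul_left_cancel₀ h3
  linear_combination -h1

/-- Write $c_n=\binom{\gamma}{n}$. For $n\ge\gamma$ the recurrence reads
$(n+1)|c_{n+1}|=(n-\gamma)|c_n|$, so $\gamma|c_n|=n|c_n|-(n+1)|c_{n+1}|$ telescopes and the partial
sums stay bounded. -/
theorem summable_abs_choose {γ : ℝ} (hγ : 0 < γ) :
    Summable fun n : ℕ => |Ring.choose γ n| := by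
  obtain ⟨N, hN⟩ := exists_nat_ge γ
  rw [← summable_nat_add_iff N]
  have key : ∀ k : ℕ, γ * |Ring.choose γ (k + N)| =
      ((k + N : ℕ) : ℝ) * |Ring.choose γ (k + N)| -
        ((k + 1 + N : ℕ) : ℝ) * |Ring.choose γ (k + 1 + N)| := by
    intro k
    have h := succ_mul_choose_succ γ (k + N)
    have h' := congrArg abs h
    rw [abs_mul, abs_mul, abs_of_nonneg (by positivity : (0 : ℝ) ≤ ((k + N : ℕ) : ℝ) + 1),
      abs_of_nonpos (a := γ - ((k + N : ℕ) : ℝ))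
        (by push_cast; linarith [(Nat.cast_nonneg k : (0 : ℝ) ≤ k)])] at h'
    rw [show k + 1 + N = k + N + 1 by ring]
    push_cast at h' ⊢
    linarith
  refine summable_of_sum_range_le (c := (N : ℝ) * |Ring.choose γ N| / γ)
    (fun _ => abs_nonneg _) fun n => ?_
  rw [le_div_iff₀ hγ, mul_comm, Finset.mul_sum, Finset.sum_congr rfl fun k _ => key k,
    Finset.sum_range_sub' (fun k : ℕ => ((k + N : ℕ) : ℝ) * |Ring.choose γ (k + N)|)]
  simp only [Nat.zero_add]
  have : 0 ≤ ((n + N : ℕ) : ℝ) * |Ring.choose γ (n + N)| := by positivity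
  linarith

theorem hasSum_choose_mul_pow (γ : ℝ) {y : ℝ} (hy : |y| < 1) :
    HasSum (fun n : ℕ => Ring.choose γ n * y ^ n) ((1 + y) ^ γ) := by
  have h := (Real.one_add_rpow_hasFPowerSeriesOnBall_zero (a := γ)).hasSum (y := y) (by
    simpa [Metric.mem_eball, edist_dist, Real.dist_eq] using hy)
  simpa [binomialSeries, FormalMultilinearSeries.ofScalars_apply_eq, mul_comm] using h

theorem summable_coeff {γ x : ℝ} (hγ : 0 < γ) (hx : -1 < x) :
    Summable fun n : ℕ => x * (-1) ^ n / (n + x) * Ring.choose γ n := by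
  -- The term $n=0$ has denominator $x$, of unknown sign; from $n=1$ on, $n+x\ge1+x>0$.
  rw [← summable_nat_add_iff 1]
  refine Summable.of_norm_bounded
    (((summable_nat_add_iff 1).2 (summable_abs_choose hγ)).mul_left (|x| / (1 + x))) fun n => ?_
  have h1 : (0 : ℝ) < 1 + x := by linarith
  have h2 : (1 + x) ≤ |((n + 1 : ℕ) : ℝ) + x| := by
    rw [abs_of_pos] <;> push_cast <;> linarith [(Nat.cast_nonneg n : (0 : ℝ) ≤ n)]
  rw [norm_mul, norm_div, norm_mul, norm_pow, norm_neg, norm_one, one_pow, mul_one,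
    Real.norm_eq_abs, Real.norm_eq_abs, Real.norm_eq_abs]
  gcongr

/-- The term $n=0$ is $1$. Since $1/(n+x)=\int_0^1t^{n+x-1}dt$ for $n\ge1$, the rest equals
$\int_0^1 x\,t^{x-1}\bigl((1-t)^\gamma-1\bigr)dt$, which is nonnegative because $x<0$ and
$(1-t)^\gamma\le1$. -/
theorem one_le_tsum_coeff {γ x : ℝ} (hγ : 0 < γ) (hx : -1 < x) (hx0 : x < 0) :
    1 ≤ ∑' n : ℕ, x * (-1) ^ n / (n + x) * Ring.choose γ n := by
  have hs := summable_coeff hγ hx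
  rw [hs.tsum_eq_zero_add]
  simp only [Nat.cast_zero, pow_zero, zero_add, mul_one, Ring.choose_zero_right, div_self hx0.ne]
  suffices 0 ≤ ∑' n : ℕ, x * (-1) ^ (n + 1) / ((n + 1 : ℕ) + x) * Ring.choose γ (n + 1) by
    linarith
  -- Indices are shifted: `F n` is the integrand of the term $n+1$, so its exponent $n+x$ exceeds
  -- $-1$.
  let F : ℕ → ℝ → ℝ := fun n t => x * (-1) ^ (n + 1) * Ring.choose γ (n + 1) * t ^ ((n : ℝ) + x)
  have hint : ∀ n : ℕ, Integrable (fun t : ℝ => t ^ ((n : ℝ) + x))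
      (volume.restrict (Set.Ioc 0 1)) := fun n =>
    (intervalIntegral.intervalIntegrable_rpow' (a := 0) (b := 1)
      (by linarith [(Nat.cast_nonneg n : (0 : ℝ) ≤ n)])).1
  have hval : ∀ n : ℕ, ∫ t in Set.Ioc (0 : ℝ) 1, t ^ ((n : ℝ) + x) = 1 / ((n + 1 : ℕ) + x) := by
    intro n
    have hn : (0 : ℝ) ≤ n := Nat.cast_nonneg n
    rw [← intervalIntegral.integral_of_le zero_le_one, integral_rpow (Or.inl (by linarith)),
      Real.one_rpow, Real.zero_rpow (by linarith)]
    push_cast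
    ring
  have hF : ∀ n, Integrable (F n) (volume.restrict (Set.Ioc 0 1)) := fun n => (hint n).const_mul _
  have hFv : ∀ n, ∫ t in Set.Ioc (0 : ℝ) 1, F n t =
      x * (-1) ^ (n + 1) / ((n + 1 : ℕ) + x) * Ring.choose γ (n + 1) := by
    intro n
    simp only [F]
    rw [integral_const_mul, hval]
    ring
  have hFn : Summable fun n => ∫ t in Set.Ioc (0 : ℝ) 1, ‖F n t‖ := by
    refine ((summable_nat_add_iff 1).2 hs).norm.congr fun n => ?_
    have h1 : ∀ t ∈ Set.Ioc (0 : ℝ) 1, ‖F n t‖ =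
        |x * (-1) ^ (n + 1) * Ring.choose γ (n + 1)| * t ^ ((n : ℝ) + x) := by
      intro t ht
      simp only [F]
      rw [norm_mul, Real.norm_eq_abs, Real.norm_eq_abs, abs_of_nonneg (Real.rpow_nonneg ht.1.le _)]
    rw [setIntegral_congr_fun measurableSet_Ioc h1, integral_const_mul, hval, Real.norm_eq_abs]
    have hn : (0 : ℝ) < ((n + 1 : ℕ) : ℝ) + x := by
      push_cast
      linarith [(Nat.cast_nonneg n : (0 : ℝ) ≤ n)]
    rw [← abs_of_pos (one_div_pos.2 hn), ← abs_mul]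
    congr 1
    ring
  have hsum := hasSum_integral_of_summable_integral_norm hF hFn
  simp only [hFv] at hsum
  rw [hsum.tsum_eq]
  refine setIntegral_nonneg_of_ae_restrict ?_
  rw [Filter.EventuallyLE, ae_restrict_iff' measurableSet_Ioc]
  -- The binomial series is available only for $|t|<1$, so the endpoint is discarded as a null set.
  have hne : ∀ᵐ t : ℝ, t ≠ 1 := by simp [ae_iff]
  filter_upwards [hne] with t ht1 ht
  have ht' : t < 1 := lt_of_le_of_ne ht.2 ht1
  have hb := hasSum_choose_mul_pow γ (y := -t) (by rw [abs_neg, abs_of_pos ht.1]; exact ht')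
  have hb' := (hasSum_nat_add_iff' 1).2 hb
  have hb2 := hb'.mul_left (x * t ^ (x - 1))
  have hEq : (fun n : ℕ => x * t ^ (x - 1) * (Ring.choose γ (n + 1) * (-t) ^ (n + 1))) =
      fun n => F n t := by
    funext n
    simp only [F]
    rw [neg_pow, show (n : ℝ) + x = (x - 1) + ((n + 1 : ℕ) : ℝ) by push_cast; ring,
      Real.rpow_add ht.1, Real.rpow_natCast]
    ring
  rw [hEq] at hb2
  rw [hb2.tsum_eq]
  have h1 : (1 + -t) ^ γ ≤ 1 := Real.rpow_le_one (by linarith) (by linarith [ht.1]) hγ.le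
  have h2 : 0 ≤ t ^ (x - 1) := Real.rpow_nonneg ht.1.le _
  simp only [Finset.range_one, Finset.sum_singleton, Ring.choose_zero_right, pow_zero, mul_one]
  exact mul_nonneg_of_nonpos_of_nonpos (mul_nonpos_of_nonpos_of_nonneg hx0.le h2) (by linarith)

/-- For $\beta\notin\mathbb N$ the coefficients are absolutely summable, so the series converges
uniformly on the closed disk; at $0$ only the constant term survives, and at $1$ the sum is at least
$1$. -/
theorem Q_properties {α β β₀ : ℝ} {m : ℕ} (hα : -1 < α) (hβ : -1 < β) (hβm : β = β₀ + m)
    (hβ₀ : β₀ ∈ Set.Ioc (-1 : ℝ) 0) :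
    ContinuousOn (Q α β) (Metric.closedBall 0 1) ∧ Q α β 0 ≠ 0 ∧ Q α β 1 ≠ 0 := by
  have hB := ProbabilityTheory.beta_pos (α := α + 1) (β := β + 1) (by linarith) (by linarith)
  have hB0 := ProbabilityTheory.beta_pos (α := α + 1) (β := β₀ + 1) (by linarith)
    (by linarith [hβ₀.1])
  by_cases hn : ∃ n : ℕ, β = n
  · have hQ : Q α β = fun _ => (((α + 1) * ProbabilityTheory.beta (α + 1) (β + 1) : ℝ) : ℂ) := by
      funext ξ
      simp only [Q, if_pos hn]
    have hne : (((α + 1) * ProbabilityTheory.beta (α + 1) (β + 1) : ℝ) : ℂ) ≠ 0 :=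
      Complex.ofReal_ne_zero.2 (mul_pos (by linarith) hB).ne'
    rw [hQ]
    exact ⟨continuousOn_const, hne, hne⟩
  · have hz : betaZero β = β₀ := hβm ▸ betaZero_add_natCast hβ₀ m
    have hβ0 : β₀ < 0 := lt_of_le_of_ne hβ₀.2 fun h => hn ⟨m, by simpa [h] using hβm⟩
    have hγ : 0 < α + 1 := by linarith
    set c : ℕ → ℝ := fun n => β₀ * (-1) ^ n / (n + β₀) * Ring.choose (α + 1) n with hc
    have hs : Summable c := summable_coeff hγ hβ₀.1
    set κ : ℝ := ProbabilityTheory.beta (α + 1) (β + 1) / ProbabilityTheory.beta (α + 1) (β₀ + 1)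
      with hκ
    have hκ0 : (κ : ℂ) ≠ 0 := Complex.ofReal_ne_zero.2 (div_pos hB hB0).ne'
    have hQ : Q α β = fun ξ => (κ : ℂ) * ∑' n : ℕ, (c n : ℂ) * ξ ^ n := by
      funext ξ
      simp only [Q, if_neg hn, hz]
      congr 1
      refine tsum_congr fun n => ?_
      simp only [hc]
      push_cast
      rw [neg_pow]
      ring
    rw [hQ]
    refine ⟨continuousOn_const.mul (continuousOn_tsum (u := fun n => |c n|)
      (fun n => by fun_prop) hs.abs fun n ξ hξ => ?_), mul_ne_zero hκ0 ?_, mul_ne_zero hκ0 ?_⟩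
    · rw [norm_mul, norm_pow, Complex.norm_real, Real.norm_eq_abs]
      exact mul_le_of_le_one_right (abs_nonneg _)
        (pow_le_one₀ (norm_nonneg _) (by simpa using hξ))
    · rw [tsum_eq_single 0 fun n hn => by simp [hn]]
      simp [hc, hβ0.ne]
    · simp only [one_pow, mul_one]
      rw [← Complex.ofReal_tsum]
      have := one_le_tsum_coeff hγ hβ₀.1 hβ0
      exact Complex.ofReal_ne_zero.2 (by simp only [hc]; linarith)

/-! ### One-dimensional integrals of powers -/

/-- A power is monotone in one direction or the other, so it is at most the larger endpoint value;
taking the sum avoids a case split on the sign of the exponent. -/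
theorem rpow_le_rpow_add_rpow {l u x : ℝ} (e : ℝ) (hl : 0 < l) (hx : l ≤ x) (hu : x ≤ u) :
    x ^ e ≤ l ^ e + u ^ e := by
  have h1 : 0 ≤ l ^ e := Real.rpow_nonneg hl.le e
  have h2 : 0 ≤ u ^ e := Real.rpow_nonneg (hl.le.trans (hx.trans hu)) e
  rcases le_total 0 e with he | he
  · linarith [Real.rpow_le_rpow (hl.le.trans hx) hu he]
  · linarith [Real.rpow_le_rpow_of_nonpos hl hx he]

theorem lintegral_Ioi_rpow {e t : ℝ} (he : e < -1) (ht : 0 < t) :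
    ∫⁻ x in Set.Ioi t, ENNReal.ofReal (x ^ e) = ENNReal.ofReal (t ^ (e + 1) / (-(e + 1))) := by
  rw [← ofReal_integral_eq_lintegral_ofReal (integrableOn_Ioi_rpow_of_lt he ht),
    integral_Ioi_rpow_of_lt he ht, div_neg, neg_div]
  exact (ae_restrict_iff' measurableSet_Ioi).2 (Filter.Eventually.of_forall fun x hx =>
    Real.rpow_nonneg (ht.le.trans (le_of_lt hx)) e)

theorem lintegral_Ioc_rpow {e t : ℝ} (he : -1 < e) (ht : 0 < t) :
    ∫⁻ x in Set.Ioc 0 t, ENNReal.ofReal (x ^ e) = ENNReal.ofReal (t ^ (e + 1) / (e + 1)) := by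
  rw [← ofReal_integral_eq_lintegral_ofReal
    (intervalIntegral.intervalIntegrable_rpow' (a := 0) (b := t) he).1,
    ← intervalIntegral.integral_of_le ht.le, integral_rpow (Or.inl he),
    Real.zero_rpow (by linarith), sub_zero]
  exact (ae_restrict_iff' measurableSet_Ioc).2 (Filter.Eventually.of_forall fun x hx =>
    Real.rpow_nonneg hx.1.le e)

/-- Split at $x=t$, using $t+x\ge t$ below and $t+x\ge x$ above. The two conditions on $s$ give
convergence at $0$ and at $\infty$. -/
theorem lintegral_rpow_mul_add_rpow_le {s α t : ℝ} (hs : -1 < s) (hsα : s < α) (ht : 0 < t) :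
    ∫⁻ x in Set.Ioi (0 : ℝ), ENNReal.ofReal (x ^ s * (t + x) ^ (-(1 + α))) ≤
      ENNReal.ofReal ((1 / (s + 1) + 1 / (α - s)) * t ^ (s - α)) := by
  rw [← Set.Ioc_union_Ioi_eq_Ioi ht.le, lintegral_union measurableSet_Ioi
    (Set.Ioc_disjoint_Ioi le_rfl), add_mul, ENNReal.ofReal_add]
  rotate_left
  · have : 0 < s + 1 := by linarith
    positivity
  · have : 0 < α - s := by linarith
    positivity
  refine add_le_add ?_ ?_
  · calc ∫⁻ x in Set.Ioc 0 t, ENNReal.ofReal (x ^ s * (t + x) ^ (-(1 + α)))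
        ≤ ∫⁻ x in Set.Ioc 0 t, ENNReal.ofReal (t ^ (-(1 + α))) * ENNReal.ofReal (x ^ s) := by
          refine setLIntegral_mono' measurableSet_Ioc fun x hx => ?_
          rw [← ENNReal.ofReal_mul (by positivity), mul_comm]
          refine ENNReal.ofReal_le_ofReal (mul_le_mul_of_nonneg_right
            (Real.rpow_le_rpow_of_nonpos ht (by linarith [hx.1]) (by linarith))
            (Real.rpow_nonneg hx.1.le s))
      _ = ENNReal.ofReal (1 / (s + 1) * t ^ (s - α)) := by
          rw [lintegral_const_mul' _ _ ENNReal.ofReal_ne_top, lintegral_Ioc_rpow hs ht,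
            ← ENNReal.ofReal_mul (by positivity), mul_div_assoc', ← Real.rpow_add ht]
          ring_nf
      _ ≤ _ := le_rfl
  · calc ∫⁻ x in Set.Ioi t, ENNReal.ofReal (x ^ s * (t + x) ^ (-(1 + α)))
        ≤ ∫⁻ x in Set.Ioi t, ENNReal.ofReal (x ^ (s - α - 1)) := by
          refine setLIntegral_mono' measurableSet_Ioi fun x hx => ?_
          have hx' : t < x := hx
          have hx0 : 0 < x := ht.trans hx'
          rw [show s - α - 1 = s + -(1 + α) by ring, Real.rpow_add hx0]
          exact ENNReal.ofReal_le_ofReal (mul_le_mul_of_nonneg_left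
            (Real.rpow_le_rpow_of_nonpos hx0 (by linarith) (by linarith))
            (Real.rpow_nonneg hx0.le s))
      _ = ENNReal.ofReal (1 / (α - s) * t ^ (s - α)) := by
          rw [lintegral_Ioi_rpow (by linarith) ht]
          ring_nf
      _ ≤ _ := le_rfl

theorem lintegral_add_abs_rpow_le {e t : ℝ} (he : e < -1) (ht : 0 < t) :
    ∫⁻ θ : ℝ, ENNReal.ofReal ((t + |θ|) ^ e) ≤
      ENNReal.ofReal (2 * (t ^ (e + 1) / (-(e + 1)))) := by
  have hpos : ∫⁻ θ in Set.Ioi (0 : ℝ), ENNReal.ofReal ((t + |θ|) ^ e) =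
      ENNReal.ofReal (t ^ (e + 1) / (-(e + 1))) := by
    rw [← lintegral_Ioi_rpow he ht]
    have := (measurePreserving_add_left volume t).setLIntegral_comp_preimage_emb
      (MeasurableEquiv.addLeft t).measurableEmbedding (fun x => ENNReal.ofReal (x ^ e)) (Set.Ioi t)
    rw [← this]
    simp only [Set.preimage_const_add_Ioi, sub_self]
    refine setLIntegral_congr_fun measurableSet_Ioi fun x hx => ?_
    simp only [abs_of_pos (show (0 : ℝ) < x from hx)]
  have hneg : ∫⁻ θ in Set.Iio (0 : ℝ), ENNReal.ofReal ((t + |θ|) ^ e) =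
      ENNReal.ofReal (t ^ (e + 1) / (-(e + 1))) := by
    rw [← hpos]
    have := (Measure.measurePreserving_neg (volume : Measure ℝ)).setLIntegral_comp_preimage_emb
      (MeasurableEquiv.neg ℝ).measurableEmbedding
      (fun x => ENNReal.ofReal ((t + |x|) ^ e)) (Set.Ioi 0)
    rw [← this]
    simp
  rw [← setLIntegral_univ, ← Set.Iic_union_Ioi (a := (0 : ℝ))]
  refine (lintegral_union_le _ _ _).trans ?_
  rw [setLIntegral_congr Iio_ae_eq_Iic.symm, hpos, hneg, ← ENNReal.ofReal_add, two_mul]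
  · exact div_nonneg (by positivity) (by linarith)
  · exact div_nonneg (by positivity) (by linarith)

/-! ### Polar coordinates on the disk -/

theorem lintegral_ball_polar {F : ℂ → ℝ≥0∞} (hF : Measurable F) :
    ∫⁻ z in Metric.ball (0 : ℂ) 1, F z =
      ∫⁻ r in Set.Ioo (0 : ℝ) 1, ∫⁻ θ in Set.Ioo (-Real.pi) Real.pi,
        ENNReal.ofReal r * F (r * Complex.exp (θ * Complex.I)) := by
  rw [← lintegral_indicator Metric.isOpen_ball.measurableSet,
    ← Complex.lintegral_comp_polarCoord_symm, polarCoord_target, Measure.volume_eq_prod,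
    setLIntegral_prod]
  · have hsub : Set.Ioo (0 : ℝ) 1 = Set.Ioi 0 ∩ Set.Iio 1 := by
      ext; simp
    rw [hsub, Set.inter_comm, ← setLIntegral_indicator measurableSet_Iio]
    refine setLIntegral_congr_fun measurableSet_Ioi fun r hr => ?_
    have hr' : 0 < r := hr
    by_cases h : r < 1
    · rw [Set.indicator_of_mem (show r ∈ Set.Iio 1 from h)]
      refine lintegral_congr fun θ => ?_
      have : (Complex.polarCoord.symm (r, θ)) = r * Complex.exp (θ * Complex.I) := by
        rw [Complex.polarCoord_symm_apply, Complex.exp_mul_I]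
        simp
      rw [this, Set.indicator_of_mem, smul_eq_mul]
      simpa [Complex.norm_exp_ofReal_mul_I, abs_of_pos hr'] using h
    · rw [Set.indicator_of_notMem (show r ∉ Set.Iio 1 from h)]
      refine (lintegral_congr fun θ => ?_).trans lintegral_zero
      have : (Complex.polarCoord.symm (r, θ)) = r * Complex.exp (θ * Complex.I) := by
        rw [Complex.polarCoord_symm_apply, Complex.exp_mul_I]
        simp
      rw [this, Set.indicator_of_notMem, smul_zero]
      simpa [Complex.norm_exp_ofReal_mul_I, abs_of_pos hr'] using h
  · have hm : Measurable fun x : ℝ × ℝ => Complex.polarCoord.symm x := by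
      simp only [Complex.polarCoord_symm_apply]
      fun_prop
    exact ((measurable_fst.ennreal_ofReal).mul
      ((hF.indicator Metric.isOpen_ball.measurableSet).comp hm)).aemeasurable

theorem lintegral_ball_radial {F : ℝ → ℝ≥0∞} (hF : Measurable F) :
    ∫⁻ z in Metric.ball (0 : ℂ) 1, F ‖z‖ =
      ENNReal.ofReal (2 * Real.pi) * ∫⁻ r in Set.Ioo (0 : ℝ) 1, ENNReal.ofReal r * F r := by
  rw [lintegral_ball_polar (F := fun z => F ‖z‖) (hF.comp measurable_norm),
    ← lintegral_const_mul' _ _ ENNReal.ofReal_ne_top]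
  refine setLIntegral_congr_fun measurableSet_Ioo fun r hr => ?_
  have : ∀ θ : ℝ, ‖(r : ℂ) * Complex.exp (θ * Complex.I)‖ = r := fun θ => by
    simp [Complex.norm_exp_ofReal_mul_I, abs_of_pos hr.1]
  simp only [this, lintegral_const, Measure.restrict_apply_univ, Real.volume_Ioo]
  rw [mul_comm]
  congr 2
  ring

/-- Let $N=|1-xe^{i\theta}|$. Then $1-x\le N$, and
$|\theta|/2\le2|\sin(\theta/2)|=|1-e^{i\theta}|\le N+(1-x)\le2N$. Hence $(1-x)+|\theta|\le5N$. -/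
theorem add_abs_le_norm_one_sub {x θ : ℝ} (hx0 : 0 ≤ x) (hx1 : x ≤ 1) (hθ : |θ| ≤ Real.pi) :
    1 / 6 * ((1 - x) + |θ|) ≤ ‖1 - (x : ℂ) * Complex.exp (θ * Complex.I)‖ := by
  have h1 : 1 - x ≤ ‖1 - (x : ℂ) * Complex.exp (θ * Complex.I)‖ := by
    have := norm_sub_norm_le (1 : ℂ) ((x : ℂ) * Complex.exp (θ * Complex.I))
    simpa [Complex.norm_exp_ofReal_mul_I, abs_of_nonneg hx0] using this
  have h2 : ‖1 - Complex.exp (θ * Complex.I)‖ ≤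
      ‖1 - (x : ℂ) * Complex.exp (θ * Complex.I)‖ + (1 - x) := by
    have : (1 : ℂ) - Complex.exp (θ * Complex.I) = (1 - (x : ℂ) * Complex.exp (θ * Complex.I)) +
        ((x - 1 : ℝ) : ℂ) * Complex.exp (θ * Complex.I) := by push_cast; ring
    rw [this]
    refine (norm_add_le _ _).trans ?_
    rw [norm_mul, Complex.norm_exp_ofReal_mul_I, Complex.norm_real, Real.norm_eq_abs,
      abs_of_nonpos (by linarith)]
    linarith
  have h3 : ‖1 - Complex.exp (θ * Complex.I)‖ = 2 * |Real.sin (θ / 2)| := by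
    rw [norm_sub_rev, mul_comm, Complex.norm_exp_I_mul_ofReal_sub_one, norm_mul]
    simp
  have h4 := Real.mul_abs_le_abs_sin (x := θ / 2) (by
    rw [abs_div, abs_two]; linarith)
  have h5 : 1 / 2 ≤ 2 / Real.pi := by
    rw [div_le_div_iff₀ two_pos Real.pi_pos]; linarith [Real.pi_le_four]
  have h6 : 1 / 2 * |θ / 2| ≤ |Real.sin (θ / 2)| :=
    (mul_le_mul_of_nonneg_right h5 (abs_nonneg _)).trans h4
  rw [abs_div, abs_two] at h6
  linarith [abs_nonneg θ]

theorem lintegral_ball_rotation (u : Circle) (G : ℂ → ℝ≥0∞) :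
    ∫⁻ w in Metric.ball (0 : ℂ) 1, G (u * w) = ∫⁻ w in Metric.ball (0 : ℂ) 1, G w := by
  have h := (rotation u).measurePreserving.setLIntegral_comp_preimage_emb
    (rotation u).toHomeomorph.measurableEmbedding G (Metric.ball 0 1)
  have hp : (rotation u) ⁻¹' Metric.ball (0 : ℂ) 1 = Metric.ball 0 1 := by
    ext w
    simp only [Set.mem_preimage, mem_ball_zero_iff, LinearIsometryEquiv.norm_map]
  rw [← h, hp]
  simp [rotation_apply]

/-- Separates the singularity of $\rho^{c+1}$ at $0$ from the boundary behaviour. For $\rho\le1/2$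
the other factors are bounded and $(1-r)^{s-\alpha}\ge1$; for $\rho\ge1/2$ the power of $\rho$ is
bounded and $1-r\rho\ge\frac12\bigl((1-r)+(1-\rho)\bigr)$. -/
theorem radial_kernel_bound {s α c : ℝ} (hα : -1 < α) (hsα : s < α) :
    ∃ K : ℝ, 0 ≤ K ∧ ∀ r ∈ Set.Ico (0 : ℝ) 1, ∀ ρ ∈ Set.Ioo (0 : ℝ) 1,
      ρ ^ (c + 1) * (1 - ρ ^ 2) ^ s * (1 - r * ρ) ^ (-(1 + α)) ≤
        K * (ρ ^ (c + 1) * (1 - r) ^ (s - α) +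
          (1 - ρ) ^ s * ((1 - r) + (1 - ρ)) ^ (-(1 + α))) := by
  have half : (0 : ℝ) < 1 / 2 := by norm_num
  set K1 : ℝ := ((1 / 2 : ℝ) ^ s + 1 ^ s) * (1 / 2 : ℝ) ^ (-(1 + α)) with hK1
  set K2 : ℝ := ((1 / 2 : ℝ) ^ (c + 1) + 1 ^ (c + 1)) * (1 ^ s + 2 ^ s) *
    (1 / 2 : ℝ) ^ (-(1 + α)) with hK2
  have hK1' : 0 ≤ K1 := by positivity
  have hK2' : 0 ≤ K2 := by positivity
  refine ⟨K1 + K2, by positivity, fun r hr ρ hρ => ?_⟩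
  obtain ⟨hr0, hr1⟩ := hr
  obtain ⟨hρ0, hρ1⟩ := hρ
  have hr1' : 0 < 1 - r := by linarith
  have hρ1' : 0 < 1 - ρ := by linarith
  have hA : 0 ≤ ρ ^ (c + 1) * (1 - r) ^ (s - α) := by positivity
  have hB : 0 ≤ (1 - ρ) ^ s * ((1 - r) + (1 - ρ)) ^ (-(1 + α)) := by positivity
  rcases le_total ρ (1 / 2) with h | h
  · have h1 : (1 - ρ ^ 2) ^ s ≤ (1 / 2 : ℝ) ^ s + 1 ^ s :=
      rpow_le_rpow_add_rpow s half (by nlinarith) (by nlinarith)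
    have h2 : (1 - r * ρ) ^ (-(1 + α)) ≤ (1 / 2 : ℝ) ^ (-(1 + α)) :=
      Real.rpow_le_rpow_of_nonpos half (by nlinarith) (by linarith)
    have h3 : 1 ≤ (1 - r) ^ (s - α) :=
      Real.one_le_rpow_of_pos_of_le_one_of_nonpos hr1' (by linarith) (by linarith)
    have h4 : 0 ≤ 1 - ρ ^ 2 := by nlinarith
    have h5 : 0 ≤ 1 - r * ρ := by nlinarith
    calc ρ ^ (c + 1) * (1 - ρ ^ 2) ^ s * (1 - r * ρ) ^ (-(1 + α))
        ≤ ρ ^ (c + 1) * ((1 / 2 : ℝ) ^ s + 1 ^ s) * (1 / 2 : ℝ) ^ (-(1 + α)) := by gcongr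
      _ = K1 * (ρ ^ (c + 1) * 1) := by rw [hK1]; ring
      _ ≤ K1 * (ρ ^ (c + 1) * (1 - r) ^ (s - α)) := by gcongr
      _ ≤ _ := by nlinarith
  · have h1 : ρ ^ (c + 1) ≤ (1 / 2 : ℝ) ^ (c + 1) + 1 ^ (c + 1) :=
      rpow_le_rpow_add_rpow _ half h hρ1.le
    have h2 : (1 + ρ) ^ s ≤ 1 ^ s + 2 ^ s :=
      rpow_le_rpow_add_rpow s one_pos (by linarith) (by linarith)
    have h3 : (1 - ρ ^ 2) ^ s = (1 - ρ) ^ s * (1 + ρ) ^ s := by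
      rw [← Real.mul_rpow hρ1'.le (by linarith)]
      ring_nf
    have h4 : (1 - r * ρ) ^ (-(1 + α)) ≤
        (1 / 2 : ℝ) ^ (-(1 + α)) * ((1 - r) + (1 - ρ)) ^ (-(1 + α)) := by
      rw [← Real.mul_rpow half.le (by linarith)]
      exact Real.rpow_le_rpow_of_nonpos (by positivity) (by nlinarith) (by linarith)
    have h5 : 0 ≤ 1 - r * ρ := by nlinarith
    rw [h3]
    calc ρ ^ (c + 1) * ((1 - ρ) ^ s * (1 + ρ) ^ s) * (1 - r * ρ) ^ (-(1 + α))
        ≤ ((1 / 2 : ℝ) ^ (c + 1) + 1 ^ (c + 1)) * ((1 - ρ) ^ s * (1 ^ s + 2 ^ s)) *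
          ((1 / 2 : ℝ) ^ (-(1 + α)) * ((1 - r) + (1 - ρ)) ^ (-(1 + α))) := by gcongr
      _ = K2 * ((1 - ρ) ^ s * ((1 - r) + (1 - ρ)) ^ (-(1 + α))) := by rw [hK2]; ring
      _ ≤ _ := by nlinarith

/-- A rotation reduces to $z=r\ge0$. Integration over the angle turns $|1-z\bar w|^{-(2+\alpha)}$
into a multiple of $(1-r\rho)^{-(1+\alpha)}$, and the radial integral is then of order
$(1-r)^{s-\alpha}$. The condition $c>-2$ is integrability of $|w|^c$ at the origin. -/
theorem forelli_rudin {s α c : ℝ} (hs : -1 < s) (hsα : s < α) (hc : -2 < c) :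
    ∃ C : ℝ≥0, ∀ z ∈ Metric.ball (0 : ℂ) 1,
      ∫⁻ w in Metric.ball (0 : ℂ) 1,
        ENNReal.ofReal (‖w‖ ^ c * (1 - ‖w‖ ^ 2) ^ s / ‖1 - z * conj w‖ ^ (2 + α)) ≤
      C * ENNReal.ofReal ((1 - ‖z‖ ^ 2) ^ (s - α)) := by
  have hα : -1 < α := hs.trans hsα
  obtain ⟨K, hK0, hK⟩ := radial_kernel_bound (c := c) hα hsα
  set D : ℝ := (1 / 6 : ℝ) ^ (-(2 + α)) * (2 / (1 + α)) with hD
  have hD0 : 0 ≤ D := by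
    have : 0 < 1 + α := by linarith
    positivity
  set E : ℝ := 1 / (c + 2) + (1 / (s + 1) + 1 / (α - s)) with hE
  have hE1 : 0 < c + 2 := by linarith
  have hE2 : 0 < s + 1 := by linarith
  have hE3 : 0 < α - s := by linarith
  have hE0 : 0 ≤ E := by positivity
  -- `D` comes from the angular integral, `K` from the radial bound, `E` from the one-dimensional
  -- integrals; the last factor passes from $1-r$ to $1-r^2\le2(1-r)$ under a negative exponent.
  refine ⟨Real.toNNReal (D * K * E * (1 / 2 : ℝ) ^ (s - α)), fun z hz => ?_⟩
  have hz1 : ‖z‖ < 1 := by simpa using hz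
  obtain ⟨u, hu⟩ : ∃ u : Circle, z = ‖z‖ * u := by
    refine ⟨Circle.exp z.arg, ?_⟩
    rw [Circle.coe_exp, Complex.norm_mul_exp_arg_mul_I]
  set r := ‖z‖ with hr
  have hr0 : 0 ≤ r := norm_nonneg z
  rw [← lintegral_ball_rotation u]
  have hrot : ∀ w : ℂ, ‖1 - z * conj ((u : ℂ) * w)‖ = ‖1 - (r : ℂ) * w‖ := by
    intro w
    have huu : (u : ℂ) * conj (u : ℂ) = 1 := by
      rw [Complex.mul_conj, Circle.normSq_coe]; simp
    rw [hu, map_mul, show (r : ℂ) * u * (conj (u : ℂ) * conj w) =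
      r * ((u : ℂ) * conj (u : ℂ)) * conj w by ring, huu, mul_one,
      ← Complex.norm_conj (1 - (r : ℂ) * w)]
    simp
  simp only [hrot, norm_mul, Circle.norm_coe, one_mul]
  rw [lintegral_ball_polar (by fun_prop)]
  have hinner : ∀ ρ ∈ Set.Ioo (0 : ℝ) 1,
      ∫⁻ θ in Set.Ioo (-Real.pi) Real.pi, ENNReal.ofReal ρ *
        ENNReal.ofReal (‖(ρ : ℂ) * Complex.exp (θ * Complex.I)‖ ^ c *
          (1 - ‖(ρ : ℂ) * Complex.exp (θ * Complex.I)‖ ^ 2) ^ s /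
          ‖1 - (r : ℂ) * (ρ * Complex.exp (θ * Complex.I))‖ ^ (2 + α)) ≤
      ENNReal.ofReal (D * (ρ ^ (c + 1) * (1 - ρ ^ 2) ^ s * (1 - r * ρ) ^ (-(1 + α)))) := by
    intro ρ hρ
    have hρ1 : 0 ≤ 1 - ρ ^ 2 := by nlinarith [hρ.1, hρ.2]
    have hrρ : 0 < 1 - r * ρ := by nlinarith [hρ.1, hρ.2]
    have hn : ∀ θ : ℝ, ‖(ρ : ℂ) * Complex.exp (θ * Complex.I)‖ = ρ := fun θ => by
      simp [Complex.norm_exp_ofReal_mul_I, abs_of_pos hρ.1]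
    set L : ℝ := ρ ^ (c + 1) * (1 - ρ ^ 2) ^ s * (1 / 6 : ℝ) ^ (-(2 + α)) with hL
    have hL0 : 0 ≤ L := mul_nonneg (mul_nonneg (Real.rpow_nonneg hρ.1.le _)
      (Real.rpow_nonneg hρ1 _)) (by positivity)
    calc _ ≤ ∫⁻ θ in Set.Ioo (-Real.pi) Real.pi, ENNReal.ofReal L *
          ENNReal.ofReal (((1 - r * ρ) + |θ|) ^ (-(2 + α))) := by
          refine setLIntegral_mono' measurableSet_Ioo fun θ hθ => ?_
          rw [hn, ← ENNReal.ofReal_mul hρ.1.le, ← ENNReal.ofReal_mul hL0]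
          refine ENNReal.ofReal_le_ofReal ?_
          have h1 := add_abs_le_norm_one_sub (x := r * ρ) (θ := θ) (mul_nonneg hr0 hρ.1.le)
            (by linarith) (abs_le.2 ⟨hθ.1.le, hθ.2.le⟩)
          push_cast at h1
          rw [mul_assoc] at h1
          have h2 := Real.rpow_le_rpow_of_nonpos (z := -(2 + α)) (by positivity) h1 (by linarith)
          rw [Real.mul_rpow (by norm_num) (by positivity)] at h2
          rw [div_eq_mul_inv, ← Real.rpow_neg (norm_nonneg _), hL, Real.rpow_add_one hρ.1.ne']
          have h3 : 0 ≤ ρ ^ c * (1 - ρ ^ 2) ^ s * ρ :=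
            mul_nonneg (mul_nonneg (Real.rpow_nonneg hρ.1.le _) (Real.rpow_nonneg hρ1 _)) hρ.1.le
          linarith [mul_le_mul_of_nonneg_left h2 h3]
      _ ≤ ENNReal.ofReal L * ENNReal.ofReal (2 * ((1 - r * ρ) ^ (-(2 + α) + 1) /
            (-(-(2 + α) + 1)))) := by
          rw [lintegral_const_mul' _ _ ENNReal.ofReal_ne_top]
          gcongr
          exact (setLIntegral_le_lintegral _ _).trans
            (lintegral_add_abs_rpow_le (by linarith) hrρ)
      _ = _ := by
          rw [← ENNReal.ofReal_mul hL0, hL, hD]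
          congr 1
          rw [show -(2 + α) + 1 = -(1 + α) by ring, neg_neg]
          ring
  have hr1' : 0 < 1 - r := by linarith
  calc _ ≤ ∫⁻ ρ in Set.Ioo (0 : ℝ) 1, ENNReal.ofReal (D * K) *
        (ENNReal.ofReal ((1 - r) ^ (s - α)) * ENNReal.ofReal (ρ ^ (c + 1)) +
          ENNReal.ofReal ((1 - ρ) ^ s * ((1 - r) + (1 - ρ)) ^ (-(1 + α)))) := by
        refine setLIntegral_mono' measurableSet_Ioo fun ρ hρ => (hinner ρ hρ).trans ?_
        have hρ1' : 0 < 1 - ρ := by linarith [hρ.2]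
        have hρ0 : 0 ≤ ρ ^ (c + 1) := Real.rpow_nonneg hρ.1.le _
        rw [← ENNReal.ofReal_mul (by positivity), ← ENNReal.ofReal_add (by positivity)
          (by positivity), ← ENNReal.ofReal_mul (by positivity)]
        refine ENNReal.ofReal_le_ofReal ?_
        linarith [mul_le_mul_of_nonneg_left (hK r ⟨hr0, hz1⟩ ρ hρ) hD0]
    _ ≤ ENNReal.ofReal (D * K) * (ENNReal.ofReal ((1 - r) ^ (s - α)) * ENNReal.ofReal (1 / (c + 2))
          + ENNReal.ofReal ((1 / (s + 1) + 1 / (α - s)) * (1 - r) ^ (s - α))) := by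
        rw [lintegral_const_mul' _ _ ENNReal.ofReal_ne_top, lintegral_add_left (by fun_prop),
          lintegral_const_mul' _ _ ENNReal.ofReal_ne_top]
        gcongr
        · refine (lintegral_mono_set Set.Ioo_subset_Ioc_self).trans ?_
          rw [lintegral_Ioc_rpow (by linarith) one_pos, Real.one_rpow]
          ring_nf
          exact le_rfl
        · refine le_trans ?_ (lintegral_rpow_mul_add_rpow_le hs hsα hr1')
          have h := (Measure.measurePreserving_sub_left volume (1 : ℝ)).setLIntegral_comp_preimage_emb
            (MeasurableEquiv.subLeft (1 : ℝ)).measurableEmbedding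
            (fun x => ENNReal.ofReal (x ^ s * ((1 - r) + x) ^ (-(1 + α)))) (Set.Ioi 0)
          rw [← h]
          refine lintegral_mono_set fun x hx => ?_
          simpa using hx.2
    _ = ENNReal.ofReal (D * K * E) * ENNReal.ofReal ((1 - r) ^ (s - α)) := by
        rw [← ENNReal.ofReal_mul (by positivity), ← ENNReal.ofReal_add (by positivity)
          (by positivity), ← ENNReal.ofReal_mul (by positivity),
          ← ENNReal.ofReal_mul (by positivity), hE]
        congr 1
        ring
    _ ≤ _ := by
        have hre : ∀ x : ℝ, ((Real.toNNReal x : ℝ≥0) : ℝ≥0∞) = ENNReal.ofReal x := fun _ => rfl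
        rw [hre, ← ENNReal.ofReal_mul (by positivity), ← ENNReal.ofReal_mul (by positivity)]
        refine ENNReal.ofReal_le_ofReal ?_
        rw [mul_assoc _ ((1 / 2 : ℝ) ^ (s - α)), ← Real.mul_rpow (by norm_num) (by nlinarith)]
        exact mul_le_mul_of_nonneg_left
          (Real.rpow_le_rpow_of_nonpos (by nlinarith) (by nlinarith) (by linarith)) (by positivity)

/-! ### The Schur test -/

/-- Apply Hölder to $Kf=(K^{1/q}h)(K^{1/p}f/h)$. The row bound `h1` handles the first factor; after
Tonelli the column bound `h2` handles the second. The constants multiply to $C^{p/q}\cdot C=C^p$. -/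
theorem lintegral_schur {X : Type*} [MeasurableSpace X] {μ : Measure X} [SFinite μ] {p q : ℝ}
    (hpq : p.HolderConjugate q) {K : X → X → ℝ≥0∞} (hK : Measurable (Function.uncurry K))
    {h : X → ℝ≥0∞} (hh : Measurable h) (h0 : ∀ᵐ x ∂μ, h x ≠ 0) (ht : ∀ x, h x ≠ ∞) {C : ℝ≥0∞}
    (h1 : ∀ᵐ z ∂μ, ∫⁻ w, K z w * h w ^ q ∂μ ≤ C * h z ^ q)
    (h2 : ∀ᵐ w ∂μ, ∫⁻ z, K z w * h z ^ p ∂μ ≤ C * h w ^ p) {f : X → ℝ≥0∞} (hf : AEMeasurable f μ) :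
    ∫⁻ z, (∫⁻ w, K z w * f w ∂μ) ^ p ∂μ ≤ C ^ p * ∫⁻ w, f w ^ p ∂μ := by
  have hp := hpq.pos
  have hq := hpq.symm.pos
  have hKz : ∀ z, Measurable (K z) := fun z => hK.comp measurable_prodMk_left
  set g : X → ℝ≥0∞ := fun w => f w ^ p * (h w ^ p)⁻¹ with hg
  have hgm : AEMeasurable g μ := by fun_prop
  have step1 : ∀ᵐ z ∂μ, (∫⁻ w, K z w * f w ∂μ) ^ p ≤
      C ^ (p / q) * (h z ^ p * ∫⁻ w, K z w * g w ∂μ) := by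
    filter_upwards [h1] with z hz
    have hsplit : ∫⁻ w, K z w * f w ∂μ =
        ∫⁻ w, ((fun w => K z w ^ (1 / q) * h w) * (fun w => K z w ^ (1 / p) * (f w * (h w)⁻¹))) w
          ∂μ := by
      refine lintegral_congr_ae ?_
      filter_upwards [h0] with w hw
      have e1 : K z w = K z w ^ (1 / q) * K z w ^ (1 / p) := by
        rw [← ENNReal.rpow_add_of_nonneg _ _ (by positivity) (by positivity), one_div, one_div,
          hpq.symm.inv_add_inv_eq_one, ENNReal.rpow_one]
      have e2 : h w * (h w)⁻¹ = 1 := ENNReal.mul_inv_cancel hw (ht w)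
      calc K z w * f w = (K z w ^ (1 / q) * K z w ^ (1 / p)) * f w * (h w * (h w)⁻¹) := by
            rw [← e1, e2, mul_one]
        _ = _ := by simp only [Pi.mul_apply]; ring
    rw [hsplit]
    have hol := ENNReal.lintegral_mul_le_Lp_mul_Lq μ hpq.symm
      (f := fun w => K z w ^ (1 / q) * h w) (g := fun w => K z w ^ (1 / p) * (f w * (h w)⁻¹))
      (by have := hKz z; fun_prop) (by have := hKz z; fun_prop)
    have e3 : ∀ w, (K z w ^ (1 / q) * h w) ^ q = K z w * h w ^ q := fun w => by
      rw [ENNReal.mul_rpow_of_nonneg _ _ hq.le, ← ENNReal.rpow_mul, one_div_mul_cancel hq.ne',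
        ENNReal.rpow_one]
    have e4 : ∀ w, (K z w ^ (1 / p) * (f w * (h w)⁻¹)) ^ p = K z w * g w := fun w => by
      rw [ENNReal.mul_rpow_of_nonneg _ _ hp.le, ← ENNReal.rpow_mul, one_div_mul_cancel hp.ne',
        ENNReal.rpow_one, ENNReal.mul_rpow_of_nonneg _ _ hp.le, ENNReal.inv_rpow]
    simp only [e3, e4] at hol
    calc _ ≤ ((∫⁻ w, K z w * h w ^ q ∂μ) ^ (1 / q) * (∫⁻ w, K z w * g w ∂μ) ^ (1 / p)) ^ p := by
          gcongr
      _ ≤ ((C * h z ^ q) ^ (1 / q) * (∫⁻ w, K z w * g w ∂μ) ^ (1 / p)) ^ p := by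
          gcongr
      _ = _ := by
          rw [ENNReal.mul_rpow_of_nonneg _ _ hp.le, ENNReal.mul_rpow_of_nonneg _ _ (by positivity),
            ENNReal.mul_rpow_of_nonneg _ _ hp.le, ← ENNReal.rpow_mul, ← ENNReal.rpow_mul,
            ← ENNReal.rpow_mul, ← ENNReal.rpow_mul, one_div_mul_cancel hp.ne', ENNReal.rpow_one,
            show q * (1 / q * p) = p by field_simp, show 1 / q * p = p / q by ring, mul_assoc]
  calc ∫⁻ z, (∫⁻ w, K z w * f w ∂μ) ^ p ∂μ
      ≤ ∫⁻ z, C ^ (p / q) * (h z ^ p * ∫⁻ w, K z w * g w ∂μ) ∂μ := lintegral_mono_ae step1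
    _ = ∫⁻ z, ∫⁻ w, C ^ (p / q) * (h z ^ p * (K z w * g w)) ∂μ ∂μ := by
        refine lintegral_congr fun z => ?_
        have := hKz z
        rw [← lintegral_const_mul'' _ (by fun_prop), ← lintegral_const_mul'' _ (by fun_prop)]
    _ = ∫⁻ w, ∫⁻ z, C ^ (p / q) * (h z ^ p * (K z w * g w)) ∂μ ∂μ := by
        refine lintegral_lintegral_swap ?_
        have h3 : AEMeasurable (fun x : X × X => g x.2) (μ.prod μ) := hgm.comp_snd
        have h4 : Measurable (fun x : X × X => h x.1 ^ p) := by fun_prop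
        exact (h4.aemeasurable.mul (hK.aemeasurable.mul h3)).const_mul _
    _ = ∫⁻ w, C ^ (p / q) * (g w * ∫⁻ z, K z w * h z ^ p ∂μ) ∂μ := by
        refine lintegral_congr fun w => ?_
        have : Measurable fun z => K z w := hK.comp measurable_prodMk_right
        rw [← lintegral_const_mul'' _ (by fun_prop), ← lintegral_const_mul'' _ (by fun_prop)]
        refine lintegral_congr fun z => ?_
        ring
    _ ≤ ∫⁻ w, C ^ p * f w ^ p ∂μ := by
        refine lintegral_mono_ae ?_
        filter_upwards [h2, h0] with w hw hw0
        have hne : h w ^ p ≠ 0 := by simp [hw0, ht w]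
        have hnt : h w ^ p ≠ ∞ := by simp [hw0, ht w]
        calc C ^ (p / q) * (g w * ∫⁻ z, K z w * h z ^ p ∂μ)
            ≤ C ^ (p / q) * (g w * (C * h w ^ p)) := by gcongr
          _ = C ^ (p / q) * C * f w ^ p * ((h w ^ p)⁻¹ * h w ^ p) := by simp only [hg]; ring
          _ = C ^ p * f w ^ p := by
              rw [ENNReal.inv_mul_cancel hne hnt, mul_one]
              congr 1
              nth_rw 2 [← ENNReal.rpow_one C]
              rw [← ENNReal.rpow_add_of_nonneg _ _ (by positivity) zero_le_one]
              congr 1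
              rw [hpq.div_conj_eq_sub_one]
              ring
    _ = C ^ p * ∫⁻ w, f w ^ p ∂μ := lintegral_const_mul'' _ (by fun_prop)

/-! ### The measure `μ_{a,b}` -/

theorem measurable_density (a b : ℝ) : Measurable fun z : ℂ =>
    ENNReal.ofReal (1 / Real.pi * (1 / ProbabilityTheory.beta (a + 1) (b + 1)) *
      ‖z‖ ^ (2 * b) * (1 - ‖z‖ ^ 2) ^ a) := by
  fun_prop

theorem exists_lintegral_mu {a b : ℝ} (ha : -1 < a) (hb : -1 < b) :
    ∃ c : ℝ, 0 < c ∧ ∀ F : ℂ → ℝ≥0∞, ∫⁻ z, F z ∂(mu a b) = ENNReal.ofReal c *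
      ∫⁻ z in Metric.ball 0 1, ENNReal.ofReal (‖z‖ ^ (2 * b) * (1 - ‖z‖ ^ 2) ^ a) * F z := by
  have hB := ProbabilityTheory.beta_pos (α := a + 1) (β := b + 1) (by linarith) (by linarith)
  have hc : 0 < 1 / Real.pi * (1 / ProbabilityTheory.beta (a + 1) (b + 1)) := by
    have := Real.pi_pos
    positivity
  refine ⟨_, hc, fun F => ?_⟩
  rw [mu, lintegral_withDensity_eq_lintegral_mul_non_measurable _ (measurable_density a b)
    (Filter.Eventually.of_forall fun _ => ENNReal.ofReal_lt_top),
    ← lintegral_const_mul' _ _ ENNReal.ofReal_ne_top]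
  refine lintegral_congr fun z => ?_
  rw [Pi.mul_apply, ← mul_assoc, ← ENNReal.ofReal_mul hc.le, mul_assoc _ (‖z‖ ^ _)]

theorem ae_ball_ne_zero : ∀ᵐ z ∂((volume : Measure ℂ).restrict (Metric.ball 0 1)),
    z ∈ Metric.ball (0 : ℂ) 1 ∧ z ≠ 0 := by
  rw [ae_restrict_iff' Metric.isOpen_ball.measurableSet]
  have : ∀ᵐ z : ℂ, z ≠ 0 := by simp [ae_iff]
  filter_upwards [this] with z hz hz'
  exact ⟨hz', hz⟩

theorem ae_mu_mem (a b : ℝ) : ∀ᵐ z ∂(mu a b), z ∈ Metric.ball (0 : ℂ) 1 ∧ z ≠ 0 :=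
  (withDensity_absolutelyContinuous _ _).ae_le ae_ball_ne_zero

instance (a b : ℝ) : SFinite (mu a b) := by
  unfold mu
  infer_instance

/-! ### Kernels of Bergman type -/

/-- The properties shared by the kernels `κ` and the prefactors `φ` of the operators `A` and `B`. -/
structure IsBergmanKernel (α β a b : ℝ) (m : ℕ) (q φ : ℂ → ℂ) (κ : ℂ → ℂ → ℂ) : Prop where
  measurable_left : Measurable φ
  measurable_right : Measurable (Function.uncurry κ)
  norm_left : ∀ z, z ≠ 0 → ‖φ z‖ = ‖z‖ ^ (-(m : ℝ))
  norm_right : ∀ z ∈ Metric.ball (0 : ℂ) 1, ∀ w ∈ Metric.ball (0 : ℂ) 1, w ≠ 0 →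
    ‖κ z w‖ = ‖q (z * conj w)‖ * (1 - ‖w‖ ^ 2) ^ (α - a) * ‖w‖ ^ (2 * β - 2 * b - m) /
      ‖1 - z * conj w‖ ^ (2 + α)
  -- The remaining fields serve necessity only. Those at $w=1$ assume $\alpha=a$, when the factor
  -- $(1-|w|^2)^{\alpha-a}$ disappears and the kernel extends continuously to that boundary point.
  continuousAt_zero : ∀ w ∈ Metric.ball (0 : ℂ) 1, ContinuousAt (fun z => κ z w) 0
  continuousWithinAt_one : α = a → ∀ z ∈ Metric.ball (0 : ℂ) 1,
    ContinuousWithinAt (κ z) (Metric.ball 0 1) 1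
  norm_right_one : α = a → ∀ z ∈ Metric.ball (0 : ℂ) 1, ‖κ z 1‖ = ‖q z‖ / ‖1 - z‖ ^ (2 + α)

/-- A bound for the positive operator with kernel $|\varphi\kappa|$ gives the norm bound by the
triangle inequality. It also makes the positive integrals finite almost everywhere, which is
absolute convergence once the nonzero factor $|\varphi(z)|$ is divided out. -/
theorem isBoundedOnLp_of_lintegral_le {μ : Measure ℂ} [SFinite μ] {φ : ℂ → ℂ} {κ : ℂ → ℂ → ℂ}
    (hφ : Measurable φ) (hκ : Measurable (Function.uncurry κ)) (hφ0 : ∀ᵐ z ∂μ, φ z ≠ 0) {p : ℝ}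
    (hp : 1 ≤ p) {C : ℝ≥0} (hC : ∀ g : ℂ → ℝ≥0∞, AEMeasurable g μ →
      ∫⁻ z, (∫⁻ w, ‖φ z‖ₑ * ‖κ z w‖ₑ * g w ∂μ) ^ p ∂μ ≤ C ^ p * ∫⁻ w, g w ^ p ∂μ) :
    IsBoundedOnLp (fun f z w => f w * κ z w) (fun f z => φ z * ∫ w, f w * κ z w ∂μ)
      (ENNReal.ofReal p) μ := by
  have hp0 : 0 < p := by linarith
  have hpe0 : ENNReal.ofReal p ≠ 0 := by simpa using hp0
  refine ⟨C, fun f hf => ?_⟩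
  have hfm := hf.aestronglyMeasurable
  have hκz : ∀ z, Measurable (κ z) := fun z => hκ.comp measurable_prodMk_left
  have hfl := lintegral_rpow_enorm_lt_top_of_eLpNorm_lt_top hpe0 ENNReal.ofReal_ne_top hf.2
  have hb := hC (fun w => ‖f w‖ₑ) hfm.enorm
  rw [ENNReal.toReal_ofReal hp0.le] at hfl
  have hprod : AEStronglyMeasurable (Function.uncurry fun z w => f w * κ z w) (μ.prod μ) :=
    (hfm.comp_snd).mul hκ.aestronglyMeasurable
  have hKm : AEMeasurable (fun z => ∫⁻ w, ‖φ z‖ₑ * ‖κ z w‖ₑ * ‖f w‖ₑ ∂μ) μ := by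
    refine AEMeasurable.lintegral_prod_right' (f := fun x : ℂ × ℂ =>
      ‖φ x.1‖ₑ * ‖κ x.1 x.2‖ₑ * ‖f x.2‖ₑ) ?_
    exact (((hφ.comp measurable_fst).enorm.mul hκ.enorm).aemeasurable).mul hfm.comp_snd.enorm
  have hlt : ∫⁻ z, (∫⁻ w, ‖φ z‖ₑ * ‖κ z w‖ₑ * ‖f w‖ₑ ∂μ) ^ p ∂μ < ∞ :=
    hb.trans_lt (ENNReal.mul_lt_top (ENNReal.rpow_lt_top_of_nonneg hp0.le ENNReal.coe_ne_top) hfl)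
  have hle : ∀ z, ‖φ z * ∫ w, f w * κ z w ∂μ‖ₑ ≤ ∫⁻ w, ‖φ z‖ₑ * ‖κ z w‖ₑ * ‖f w‖ₑ ∂μ := by
    intro z
    rw [enorm_mul]
    simp only [mul_assoc]
    rw [lintegral_const_mul' _ _ enorm_ne_top]
    gcongr
    refine (enorm_integral_le_lintegral_enorm _).trans_eq (lintegral_congr fun w => ?_)
    rw [enorm_mul, mul_comm]
  have hnorm : eLpNorm (fun z => φ z * ∫ w, f w * κ z w ∂μ) (ENNReal.ofReal p) μ ≤
      C * eLpNorm f (ENNReal.ofReal p) μ := by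
    rw [eLpNorm_eq_lintegral_rpow_enorm_toReal hpe0 ENNReal.ofReal_ne_top,
      eLpNorm_eq_lintegral_rpow_enorm_toReal hpe0 ENNReal.ofReal_ne_top,
      ENNReal.toReal_ofReal hp0.le]
    calc _ ≤ ((C : ℝ≥0∞) ^ p * ∫⁻ w, ‖f w‖ₑ ^ p ∂μ) ^ (1 / p) := by
          gcongr
          exact (lintegral_mono fun z => by gcongr; exact hle z).trans hb
      _ = _ := by
          rw [ENNReal.mul_rpow_of_nonneg _ _ (by positivity), ← ENNReal.rpow_mul,
            mul_one_div_cancel hp0.ne', ENNReal.rpow_one]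
  refine ⟨?_, ⟨?_, hnorm.trans_lt (ENNReal.mul_lt_top ENNReal.coe_lt_top hf.2)⟩, hnorm⟩
  · have h1 := ae_lt_top' (hKm.pow_const p) hlt.ne
    filter_upwards [h1, hφ0] with z hz hz0
    refine ⟨hfm.mul (hκz z).aestronglyMeasurable, ?_⟩
    have h2 : ∫⁻ w, ‖φ z‖ₑ * ‖κ z w‖ₑ * ‖f w‖ₑ ∂μ < ∞ := by
      by_contra hcon
      rw [not_lt, top_le_iff] at hcon
      rw [hcon, ENNReal.top_rpow_of_pos hp0] at hz
      exact lt_irrefl _ hz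
    simp only [mul_assoc] at h2
    rw [lintegral_const_mul' _ _ enorm_ne_top] at h2
    have h3 := ENNReal.lt_top_of_mul_ne_top_right h2.ne (by simpa using hz0)
    refine lt_of_eq_of_lt (lintegral_congr fun w => ?_) h3
    rw [enorm_mul, mul_comm]
  · exact hφ.aestronglyMeasurable.mul hprod.integral_prod_right'

/-! ### Sufficiency -/

theorem mul_conj_mem_ball {z w : ℂ} (hz : z ∈ Metric.ball (0 : ℂ) 1)
    (hw : w ∈ Metric.closedBall (0 : ℂ) 1) : z * conj w ∈ Metric.ball (0 : ℂ) 1 := by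
  rw [mem_ball_zero_iff] at *
  rw [mem_closedBall_zero_iff] at hw
  rw [norm_mul, Complex.norm_conj]
  exact (mul_le_of_le_one_right (norm_nonneg z) hw).trans_lt hz

theorem one_sub_norm_sq_pos {z : ℂ} (hz : z ∈ Metric.ball (0 : ℂ) 1) : 0 < 1 - ‖z‖ ^ 2 := by
  rw [mem_ball_zero_iff] at hz
  nlinarith [norm_nonneg z]

theorem norm_one_sub_mul_conj_comm (z w : ℂ) : ‖1 - z * conj w‖ = ‖1 - w * conj z‖ := by
  rw [← Complex.norm_conj (1 - z * conj w)]
  simp [mul_comm]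

namespace IsBergmanKernel

variable {α β a b : ℝ} {m : ℕ} {q φ : ℂ → ℂ} {κ : ℂ → ℂ → ℂ}

theorem norm_mul_le (H : IsBergmanKernel α β a b m q φ κ) {M : ℝ}
    (hM : ∀ ξ ∈ Metric.closedBall (0 : ℂ) 1, ‖q ξ‖ ≤ M) {z w : ℂ} (hz : z ∈ Metric.ball (0 : ℂ) 1)
    (hz0 : z ≠ 0) (hw : w ∈ Metric.ball (0 : ℂ) 1) (hw0 : w ≠ 0) :
    ‖φ z‖ * ‖κ z w‖ ≤ M * ‖z‖ ^ (-(m : ℝ)) * ((1 - ‖w‖ ^ 2) ^ (α - a) *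
      ‖w‖ ^ (2 * β - 2 * b - m) / ‖1 - z * conj w‖ ^ (2 + α)) := by
  have h := hM _ (Metric.ball_subset_closedBall
    (mul_conj_mem_ball hz (Metric.ball_subset_closedBall hw)))
  have h1 := one_sub_norm_sq_pos hw
  rw [H.norm_left z hz0, H.norm_right z hz w hw hw0]
  have h2 : 0 ≤ ‖z‖ ^ (-(m : ℝ)) * ((1 - ‖w‖ ^ 2) ^ (α - a) *
      ‖w‖ ^ (2 * β - 2 * b - m) / ‖1 - z * conj w‖ ^ (2 + α)) := by positivity
  calc _ = ‖q (z * conj w)‖ * (‖z‖ ^ (-(m : ℝ)) * ((1 - ‖w‖ ^ 2) ^ (α - a) *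
        ‖w‖ ^ (2 * β - 2 * b - m) / ‖1 - z * conj w‖ ^ (2 + α))) := by ring
    _ ≤ M * (‖z‖ ^ (-(m : ℝ)) * ((1 - ‖w‖ ^ 2) ^ (α - a) *
        ‖w‖ ^ (2 * β - 2 * b - m) / ‖1 - z * conj w‖ ^ (2 + α))) :=
        mul_le_mul_of_nonneg_right h h2
    _ = _ := by ring

/-- Row estimate. Measure, kernel and weight combine to $|w|^{2\beta-m+x}(1-|w|^2)^{\alpha+y}$, and
the hypotheses on $x,y$ are those of `forelli_rudin`. -/
theorem exists_lintegral_right_le (H : IsBergmanKernel α β a b m q φ κ) (ha : -1 < a) (hb : -1 < b)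
    {M : ℝ} (hM : ∀ ξ ∈ Metric.closedBall (0 : ℂ) 1, ‖q ξ‖ ≤ M) {x y : ℝ}
    (hx : -2 < 2 * β - m + x) (hy : -1 < α + y) (hy0 : y < 0) :
    ∃ C : ℝ≥0, ∀ z ∈ Metric.ball (0 : ℂ) 1, z ≠ 0 →
      ∫⁻ w, ‖φ z‖ₑ * ‖κ z w‖ₑ * ENNReal.ofReal (‖w‖ ^ x * (1 - ‖w‖ ^ 2) ^ y) ∂(mu a b) ≤
        C * ENNReal.ofReal (‖z‖ ^ (-(m : ℝ)) * (1 - ‖z‖ ^ 2) ^ y) := by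
  obtain ⟨c, hc, hmu⟩ := exists_lintegral_mu ha hb
  obtain ⟨C, hC⟩ := forelli_rudin (c := 2 * β - m + x) hy (by linarith : α + y < α) hx
  have hM0 : 0 ≤ M := (norm_nonneg _).trans (hM 0 (by simp))
  refine ⟨Real.toNNReal (c * M) * C, fun z hz hz0 => ?_⟩
  have hz1 := one_sub_norm_sq_pos hz
  calc _ ≤ ENNReal.ofReal c * ∫⁻ w in Metric.ball (0 : ℂ) 1,
        ENNReal.ofReal (M * ‖z‖ ^ (-(m : ℝ))) * ENNReal.ofReal (‖w‖ ^ (2 * β - m + x) *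
          (1 - ‖w‖ ^ 2) ^ (α + y) / ‖1 - z * conj w‖ ^ (2 + α)) := by
        rw [hmu]
        refine mul_le_mul' le_rfl (lintegral_mono_ae ?_)
        filter_upwards [ae_ball_ne_zero] with w hw
        have hw1 := one_sub_norm_sq_pos hw.1
        have hw0 : 0 < ‖w‖ := norm_pos_iff.2 hw.2
        rw [← ofReal_norm, ← ofReal_norm, ← ENNReal.ofReal_mul (by positivity),
          ← ENNReal.ofReal_mul (by positivity), ← ENNReal.ofReal_mul (by positivity),
          ← ENNReal.ofReal_mul (by positivity)]
        refine ENNReal.ofReal_le_ofReal ?_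
        have h := H.norm_mul_le hM hz hz0 hw.1 hw.2
        calc ‖w‖ ^ (2 * b) * (1 - ‖w‖ ^ 2) ^ a * (‖φ z‖ * ‖κ z w‖ *
              (‖w‖ ^ x * (1 - ‖w‖ ^ 2) ^ y))
            ≤ ‖w‖ ^ (2 * b) * (1 - ‖w‖ ^ 2) ^ a * (M * ‖z‖ ^ (-(m : ℝ)) *
              ((1 - ‖w‖ ^ 2) ^ (α - a) * ‖w‖ ^ (2 * β - 2 * b - m) / ‖1 - z * conj w‖ ^ (2 + α)) *
              (‖w‖ ^ x * (1 - ‖w‖ ^ 2) ^ y)) := by gcongr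
          _ = _ := by
            rw [show 2 * β - m + x = 2 * b + (2 * β - 2 * b - m) + x by ring,
              show α + y = a + (α - a) + y by ring, Real.rpow_add hw0, Real.rpow_add hw0,
              Real.rpow_add hw1, Real.rpow_add hw1]
            ring
    _ ≤ ENNReal.ofReal c * (ENNReal.ofReal (M * ‖z‖ ^ (-(m : ℝ))) *
          (C * ENNReal.ofReal ((1 - ‖z‖ ^ 2) ^ y))) := by
        rw [lintegral_const_mul' _ _ ENNReal.ofReal_ne_top]
        gcongr
        simpa using hC z hz
    _ = _ := by
        rw [ENNReal.coe_mul, show ((Real.toNNReal (c * M) : ℝ≥0) : ℝ≥0∞) = ENNReal.ofReal (c * M)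
          from rfl, ENNReal.ofReal_mul hc.le, ENNReal.ofReal_mul hM0,
          ENNReal.ofReal_mul (by positivity)]
        ring

/-- Column estimate. `forelli_rudin` yields $(1-|w|^2)^{a+y-\alpha}$, and the kernel's own factor
$(1-|w|^2)^{\alpha-a}$ restores the exponent $y$. -/
theorem exists_lintegral_left_le (H : IsBergmanKernel α β a b m q φ κ) (ha : -1 < a) (hb : -1 < b)
    {M : ℝ} (hM : ∀ ξ ∈ Metric.closedBall (0 : ℂ) 1, ‖q ξ‖ ≤ M) {x y : ℝ}
    (hx : -2 < 2 * b - m + x) (hy : -1 < a + y) (hy0 : a + y < α) :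
    ∃ C : ℝ≥0, ∀ w ∈ Metric.ball (0 : ℂ) 1, w ≠ 0 →
      ∫⁻ z, ‖φ z‖ₑ * ‖κ z w‖ₑ * ENNReal.ofReal (‖z‖ ^ x * (1 - ‖z‖ ^ 2) ^ y) ∂(mu a b) ≤
        C * ENNReal.ofReal (‖w‖ ^ (2 * β - 2 * b - m) * (1 - ‖w‖ ^ 2) ^ y) := by
  obtain ⟨c, hc, hmu⟩ := exists_lintegral_mu ha hb
  obtain ⟨C, hC⟩ := forelli_rudin (c := 2 * b - m + x) hy hy0 hx
  have hM0 : 0 ≤ M := (norm_nonneg _).trans (hM 0 (by simp))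
  refine ⟨Real.toNNReal (c * M) * C, fun w hw hw0 => ?_⟩
  have hw1 := one_sub_norm_sq_pos hw
  calc _ ≤ ENNReal.ofReal c * ∫⁻ z in Metric.ball (0 : ℂ) 1,
        ENNReal.ofReal (M * ((1 - ‖w‖ ^ 2) ^ (α - a) * ‖w‖ ^ (2 * β - 2 * b - m))) *
          ENNReal.ofReal (‖z‖ ^ (2 * b - m + x) *
          (1 - ‖z‖ ^ 2) ^ (a + y) / ‖1 - w * conj z‖ ^ (2 + α)) := by
        rw [hmu]
        refine mul_le_mul' le_rfl (lintegral_mono_ae ?_)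
        filter_upwards [ae_ball_ne_zero] with z hz
        have hz1 := one_sub_norm_sq_pos hz.1
        have hz0 : 0 < ‖z‖ := norm_pos_iff.2 hz.2
        rw [← ofReal_norm, ← ofReal_norm, ← ENNReal.ofReal_mul (by positivity),
          ← ENNReal.ofReal_mul (by positivity), ← ENNReal.ofReal_mul (by positivity),
          ← ENNReal.ofReal_mul (by positivity)]
        refine ENNReal.ofReal_le_ofReal ?_
        have h := H.norm_mul_le hM hz.1 hz.2 hw hw0
        calc ‖z‖ ^ (2 * b) * (1 - ‖z‖ ^ 2) ^ a * (‖φ z‖ * ‖κ z w‖ *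
              (‖z‖ ^ x * (1 - ‖z‖ ^ 2) ^ y))
            ≤ ‖z‖ ^ (2 * b) * (1 - ‖z‖ ^ 2) ^ a * (M * ‖z‖ ^ (-(m : ℝ)) *
              ((1 - ‖w‖ ^ 2) ^ (α - a) * ‖w‖ ^ (2 * β - 2 * b - m) / ‖1 - z * conj w‖ ^ (2 + α)) *
              (‖z‖ ^ x * (1 - ‖z‖ ^ 2) ^ y)) := by gcongr
          _ = _ := by
            rw [show 2 * b - m + x = 2 * b + -(m : ℝ) + x by ring, Real.rpow_add hz0,
              Real.rpow_add hz0, Real.rpow_add hz1, norm_one_sub_mul_conj_comm]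
            ring
    _ ≤ ENNReal.ofReal c * (ENNReal.ofReal (M * ((1 - ‖w‖ ^ 2) ^ (α - a) *
          ‖w‖ ^ (2 * β - 2 * b - m))) * (C * ENNReal.ofReal ((1 - ‖w‖ ^ 2) ^ (a + y - α)))) := by
        rw [lintegral_const_mul' _ _ ENNReal.ofReal_ne_top]
        gcongr
        exact hC w hw
    _ = _ := by
        rw [ENNReal.coe_mul, show ((Real.toNNReal (c * M) : ℝ≥0) : ℝ≥0∞) = ENNReal.ofReal (c * M)
          from rfl, ENNReal.ofReal_mul hc.le, ENNReal.ofReal_mul hM0,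
          ENNReal.ofReal_mul (by positivity), ENNReal.ofReal_mul (by positivity),
          show y = (α - a) + (a + y - α) by ring, Real.rpow_add hw1,
          show α - a + (a + y - α) = y by ring, ENNReal.ofReal_mul (by positivity)]
        ring

theorem left_ne_zero (H : IsBergmanKernel α β a b m q φ κ) {z : ℂ} (hz : z ≠ 0) : φ z ≠ 0 := by
  rw [← norm_pos_iff, H.norm_left z hz]
  exact Real.rpow_pos_of_pos (norm_pos_iff.2 hz) _

theorem isBoundedOnLp_one (H : IsBergmanKernel α β a b m q φ κ) (ha : -1 < a) (hb : -1 < b)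
    {M : ℝ} (hM : ∀ ξ ∈ Metric.closedBall (0 : ℂ) 1, ‖q ξ‖ ≤ M) (h1 : a < α)
    (h2 : (m : ℝ) - 2 < 2 * b) (h3 : 2 * b ≤ 2 * β - m) :
    IsBoundedOnLp (fun f z w => f w * κ z w) (fun f z => φ z * ∫ w, f w * κ z w ∂(mu a b))
      (ENNReal.ofReal 1) (mu a b) := by
  obtain ⟨C, hC⟩ := H.exists_lintegral_left_le ha hb hM (x := 0) (y := 0) (by linarith)
    (by linarith) (by linarith)
  refine isBoundedOnLp_of_lintegral_le H.measurable_left H.measurable_right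
    ((ae_mu_mem a b).mono fun z hz => H.left_ne_zero hz.2) le_rfl (C := C) fun g hg => ?_
  have hKm : Measurable fun x : ℂ × ℂ => ‖φ x.1‖ₑ * ‖κ x.1 x.2‖ₑ :=
    (H.measurable_left.comp measurable_fst).enorm.mul H.measurable_right.enorm
  simp only [ENNReal.rpow_one]
  rw [lintegral_lintegral_swap (hKm.aemeasurable.mul hg.comp_snd), ← lintegral_const_mul'' _ hg]
  refine lintegral_mono_ae ?_
  filter_upwards [ae_mu_mem a b] with w hw
  have hm : Measurable fun z => ‖φ z‖ₑ * ‖κ z w‖ₑ := hKm.comp measurable_prodMk_right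
  rw [lintegral_mul_const _ hm]
  gcongr
  have h := hC w hw.1 hw.2
  simp only [Real.rpow_zero, mul_one, ENNReal.ofReal_one] at h
  -- The column integral is bounded by a multiple of $|w|^{2\beta-2b-m}$, which is at most $1$
  -- because the exponent is nonnegative; equality in `h3` is harmless.
  refine h.trans (mul_le_of_le_one_right zero_le ?_)
  rw [← ENNReal.ofReal_one]
  refine ENNReal.ofReal_le_ofReal (Real.rpow_le_one (norm_nonneg _) ?_ (by linarith))
  simpa using (mem_ball_zero_iff.1 hw.1).le

theorem isBoundedOnLp_of_one_lt (H : IsBergmanKernel α β a b m q φ κ) (ha : -1 < a) (hb : -1 < b)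
    (hα : -1 < α) (hβ : (m : ℝ) - 1 < β)
    {M : ℝ} (hM : ∀ ξ ∈ Metric.closedBall (0 : ℂ) 1, ‖q ξ‖ ≤ M) {p : ℝ} (hp : 1 < p)
    (h1 : a + 1 < p * (α + 1)) (h2 : p * m - 2 < 2 * b)
    (h3 : 2 * b < p * (2 * β + 2) - p * m - 2) :
    IsBoundedOnLp (fun f z w => f w * κ z w) (fun f z => φ z * ∫ w, f w * κ z w ∂(mu a b))
      (ENNReal.ofReal p) (mu a b) := by
  obtain ⟨r, hr⟩ : ∃ r : ℝ, p.HolderConjugate r := ⟨_, Real.HolderConjugate.conjExponent hp⟩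
  have hp0 := hr.pos
  have hr0 := hr.symm.pos
  have hpr : 1 / r = (p - 1) / p := by
    have := hr.inv_add_inv_eq_one
    rw [one_div, sub_div, div_self hp0.ne', one_div]
    linarith
  have hdiv : ∀ x : ℝ, x / r = x * (p - 1) / p := fun x => by
    rw [div_eq_mul_one_div, hpr, mul_div_assoc]
  -- With $y=-tr$ the row estimate needs $0<t<(\alpha+1)/r$; with $y=-tp$ the column estimate needs
  -- $(a-\alpha)/p<t<(a+1)/p$. The comparison of $(a-\alpha)/p$ with $(\alpha+1)/r$ is exactly `h1`.
  obtain ⟨t, ht1, ht2⟩ : ∃ t, max 0 ((a - α) / p) < t ∧ t < min ((α + 1) / r) ((a + 1) / p) := by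
    refine exists_between (max_lt (lt_min ?_ ?_) (lt_min ?_ ?_))
    · exact div_pos (by linarith) hr0
    · exact div_pos (by linarith) hp0
    · rw [hdiv]
      exact div_lt_div_of_pos_right (by linarith) hp0
    · exact div_lt_div_of_pos_right (by linarith) hp0
  -- The upper bounds on $s$ are integrability at $0$ in the two estimates; the lower bounds give
  -- $|z|^{-m}\le|z|^{-sr}$ and $|w|^{2\beta-2b-m}\le|w|^{-sp}$. The two mixed comparisons are `h2`
  -- and `h3`; the other two reduce to $m<\beta+1$.
  obtain ⟨s, hs1, hs2⟩ : ∃ s, max (m / r) ((2 * b + m - 2 * β) / p) < s ∧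
      s < min ((2 * β - m + 2) / r) ((2 * b - m + 2) / p) := by
    refine exists_between (max_lt (lt_min ?_ ?_) (lt_min ?_ ?_))
    · exact div_lt_div_of_pos_right (by linarith) hr0
    · rw [hdiv]
      exact div_lt_div_of_pos_right (by linarith) hp0
    · rw [hdiv]
      exact div_lt_div_of_pos_right (by linarith) hp0
    · exact div_lt_div_of_pos_right (by linarith) hp0
  rw [max_lt_iff, div_lt_iff₀ hp0] at ht1
  rw [lt_min_iff, lt_div_iff₀ hr0, lt_div_iff₀ hp0] at ht2
  rw [max_lt_iff, div_lt_iff₀ hp0, div_lt_iff₀ hr0] at hs1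
  rw [lt_min_iff, lt_div_iff₀ hr0, lt_div_iff₀ hp0] at hs2
  obtain ⟨C1, hC1⟩ := H.exists_lintegral_right_le ha hb hM (x := -s * r) (y := -t * r)
    (by linarith) (by linarith) (by nlinarith)
  obtain ⟨C2, hC2⟩ := H.exists_lintegral_left_le ha hb hM (x := -s * p) (y := -t * p)
    (by linarith) (by linarith) (by linarith)
  have hKm : Measurable (Function.uncurry fun z w => ‖φ z‖ₑ * ‖κ z w‖ₑ) :=
    (H.measurable_left.comp measurable_fst).enorm.mul H.measurable_right.enorm
  refine isBoundedOnLp_of_lintegral_le H.measurable_left H.measurable_right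
    ((ae_mu_mem a b).mono fun z hz => H.left_ne_zero hz.2) hp.le (C := max C1 C2) fun g hg => ?_
  have hpow : ∀ e : ℝ, 0 < e → ∀ z ∈ Metric.ball (0 : ℂ) 1,
      ENNReal.ofReal (‖z‖ ^ (-s) * (1 - ‖z‖ ^ 2) ^ (-t)) ^ e =
        ENNReal.ofReal (‖z‖ ^ (-s * e) * (1 - ‖z‖ ^ 2) ^ (-t * e)) := by
    intro e he z hz
    have hz1 := one_sub_norm_sq_pos hz
    rw [ENNReal.ofReal_rpow_of_nonneg (by positivity) he.le,
      Real.mul_rpow (by positivity) (by positivity), ← Real.rpow_mul (norm_nonneg z),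
      ← Real.rpow_mul hz1.le]
  refine lintegral_schur (h := fun z => ENNReal.ofReal (‖z‖ ^ (-s) * (1 - ‖z‖ ^ 2) ^ (-t))) hr hKm
    (by fun_prop) ?_ (fun _ => ENNReal.ofReal_ne_top) ?_ ?_ hg
  · filter_upwards [ae_mu_mem a b] with z hz
    have hz1 := one_sub_norm_sq_pos hz.1
    have hz0 : 0 < ‖z‖ := norm_pos_iff.2 hz.2
    exact (ENNReal.ofReal_pos.2 (by positivity)).ne'
  · filter_upwards [ae_mu_mem a b] with z hz
    have hz1 := one_sub_norm_sq_pos hz.1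
    have hz0 : 0 < ‖z‖ := norm_pos_iff.2 hz.2
    rw [hpow r hr0 z hz.1]
    calc _ = ∫⁻ w, ‖φ z‖ₑ * ‖κ z w‖ₑ *
          ENNReal.ofReal (‖w‖ ^ (-s * r) * (1 - ‖w‖ ^ 2) ^ (-t * r)) ∂(mu a b) := by
          refine lintegral_congr_ae ?_
          filter_upwards [ae_mu_mem a b] with w hw
          rw [hpow r hr0 w hw.1]
      _ ≤ _ := hC1 z hz.1 hz.2
      _ ≤ _ := by
          exact mul_le_mul' (ENNReal.coe_le_coe.2 (le_max_left _ _)) (ENNReal.ofReal_le_ofReal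
            (mul_le_mul_of_nonneg_right (Real.rpow_le_rpow_of_exponent_ge hz0
              (mem_ball_zero_iff.1 hz.1).le (by linarith)) (by positivity)))
  · filter_upwards [ae_mu_mem a b] with w hw
    have hw1 := one_sub_norm_sq_pos hw.1
    have hw0 : 0 < ‖w‖ := norm_pos_iff.2 hw.2
    rw [hpow p hp0 w hw.1]
    calc _ = ∫⁻ z, ‖φ z‖ₑ * ‖κ z w‖ₑ *
          ENNReal.ofReal (‖z‖ ^ (-s * p) * (1 - ‖z‖ ^ 2) ^ (-t * p)) ∂(mu a b) := by
          refine lintegral_congr_ae ?_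
          filter_upwards [ae_mu_mem a b] with z hz
          rw [hpow p hp0 z hz.1]
      _ ≤ _ := hC2 w hw.1 hw.2
      _ ≤ _ := by
          exact mul_le_mul' (ENNReal.coe_le_coe.2 (le_max_right _ _)) (ENNReal.ofReal_le_ofReal
            (mul_le_mul_of_nonneg_right (Real.rpow_le_rpow_of_exponent_ge hw0
              (mem_ball_zero_iff.1 hw.1).le (by linarith)) (by positivity)))

end IsBergmanKernel

/-! ### One-dimensional test functions -/

theorem inv_add_le_rpow {l u x : ℝ} (e : ℝ) (hl : 0 < l) (hx : l ≤ x) (hu : x ≤ u) :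
    (l ^ (-e) + u ^ (-e))⁻¹ ≤ x ^ e := by
  have hx0 : 0 < x := hl.trans_le hx
  have h := rpow_le_rpow_add_rpow (-e) hl hx hu
  rw [← neg_neg e, Real.rpow_neg hx0.le, neg_neg]
  exact inv_anti₀ (Real.rpow_pos_of_pos hx0 _) h

theorem neg_one_lt_of_lintegral_Ioo_rpow_lt_top {e t : ℝ} (ht : 0 < t)
    (h : ∫⁻ x in Set.Ioo 0 t, ENNReal.ofReal (x ^ e) < ∞) : -1 < e := by
  rw [← intervalIntegral.integrableOn_Ioo_rpow_iff ht]
  refine (lintegral_ofReal_ne_top_iff_integrable (by fun_prop) ?_).1 h.ne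
  exact (ae_restrict_iff' measurableSet_Ioo).2 (Filter.Eventually.of_forall fun x hx =>
    Real.rpow_nonneg hx.1.le e)

/-- Substitution $r=e^{-u}$. -/
theorem lintegral_inv_mul_neg_log_rpow (e : ℝ) :
    ∫⁻ r in Set.Ioo 0 (Real.exp (-1)), ENNReal.ofReal (r⁻¹ * (-Real.log r) ^ e) =
      ∫⁻ u in Set.Ioi (1 : ℝ), ENNReal.ofReal (u ^ e) := by
  have himg : (fun u => Real.exp (-u)) '' Set.Ioi (1 : ℝ) = Set.Ioo 0 (Real.exp (-1)) := by
    ext r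
    constructor
    · rintro ⟨u, hu, rfl⟩
      exact ⟨Real.exp_pos _, Real.exp_lt_exp.2 (neg_lt_neg hu)⟩
    · rintro ⟨h0, h1⟩
      refine ⟨-Real.log r, ?_, by simp [Real.exp_log h0]⟩
      have := (Real.log_lt_iff_lt_exp h0).2 h1
      simp only [Set.mem_Ioi]
      linarith
  rw [← himg, lintegral_image_eq_lintegral_abs_deriv_mul (f' := fun u => -Real.exp (-u))
    measurableSet_Ioi]
  · refine setLIntegral_congr_fun measurableSet_Ioi fun u _ => ?_
    simp only [abs_neg, Real.abs_exp, Real.log_exp, neg_neg]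
    rw [← ENNReal.ofReal_mul (Real.exp_pos _).le, ← mul_assoc,
      mul_inv_cancel₀ (Real.exp_pos _).ne', one_mul]
  · intro u _
    simpa using ((hasDerivAt_neg u).exp).hasDerivWithinAt
  · intro u _ v _ h
    simpa using h

theorem lintegral_inv_mul_neg_log_inv :
    ∫⁻ r in Set.Ioo 0 (Real.exp (-1)), ENNReal.ofReal (r⁻¹ * (-Real.log r) ^ (-1 : ℝ)) = ∞ := by
  rw [lintegral_inv_mul_neg_log_rpow]
  by_contra hcon
  have h := (lintegral_ofReal_ne_top_iff_integrable (by fun_prop)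
    ((ae_restrict_iff' measurableSet_Ioi).2 (Filter.Eventually.of_forall fun x hx =>
      Real.rpow_nonneg (zero_le_one.trans (le_of_lt hx)) _))).1 hcon
  exact lt_irrefl _ ((integrableOn_Ioi_rpow_iff one_pos).1 h)

theorem lintegral_rpow_mul_neg_log_rpow_lt_top {e p : ℝ} (hp : 1 ≤ p)
    (he : -1 ≤ e) (hep : p = 1 → -1 < e) :
    ∫⁻ r in Set.Ioo 0 (Real.exp (-1)), ENNReal.ofReal (r ^ e * (-Real.log r) ^ (-p)) < ∞ := by
  have hlog : ∀ r ∈ Set.Ioo 0 (Real.exp (-1)), 1 ≤ -Real.log r := fun r hr => by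
    have := (Real.log_lt_iff_lt_exp hr.1).2 hr.2
    linarith
  rcases he.lt_or_eq with he | he
  · refine lt_of_le_of_lt (b := ∫⁻ r in Set.Ioc 0 (Real.exp (-1)), ENNReal.ofReal (r ^ e)) ?_ ?_
    · refine (setLIntegral_mono' measurableSet_Ioo fun r hr => ?_).trans
        (lintegral_mono_set Set.Ioo_subset_Ioc_self)
      exact ENNReal.ofReal_le_ofReal (mul_le_of_le_one_right (Real.rpow_nonneg hr.1.le _)
        (Real.rpow_le_one_of_one_le_of_nonpos (hlog r hr) (by linarith)))
    · rw [lintegral_Ioc_rpow he (Real.exp_pos _)]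
      exact ENNReal.ofReal_lt_top
  · have hp1 : 1 < p := lt_of_le_of_ne hp fun h => (hep h.symm).ne he
    have := lintegral_inv_mul_neg_log_rpow (-p)
    rw [← he]
    simp only [Real.rpow_neg_one]
    rw [this, lintegral_Ioi_rpow (by linarith) one_pos]
    exact ENNReal.ofReal_lt_top

/-- If the weights `u` and `v` are comparable to powers at `0`, some `g` lies in `L^p(u)` but not in
`L^1(v)`. -/
theorem exists_test_function {u v : ℝ → ℝ} {p x y K k : ℝ} (hp : 1 ≤ p) (hK : 0 ≤ K) (hk : 0 < k)
    (hu : ∀ r ∈ Set.Ioo 0 (Real.exp (-1)), u r ≤ K * r ^ x)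
    (hv : ∀ r ∈ Set.Ioo 0 (Real.exp (-1)), k * r ^ y ≤ v r)
    (h1 : -1 ≤ x - (y + 1) * p) (h2 : p = 1 → -1 < x - (y + 1) * p) :
    ∃ g : ℝ → ℝ, Measurable g ∧ (∀ r, 0 ≤ g r) ∧
      ∫⁻ r in Set.Ioo (0 : ℝ) 1, ENNReal.ofReal (u r * g r ^ p) < ∞ ∧
      ∫⁻ r in Set.Ioo (0 : ℝ) 1, ENNReal.ofReal (v r * g r) = ∞ := by
  have hlog : ∀ r ∈ Set.Ioo 0 (Real.exp (-1)), 0 < -Real.log r := fun r hr => by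
    have := (Real.log_lt_iff_lt_exp hr.1).2 hr.2
    linarith
  have hsub : Set.Ioo 0 (Real.exp (-1)) ⊆ Set.Ioo (0 : ℝ) 1 :=
    Set.Ioo_subset_Ioo_right (Real.exp_le_one_iff.2 (by norm_num))
  -- The power makes $vg$ at least a multiple of $1/(r\log(1/r))$, which is not integrable at $0$,
  -- while $ug^p$ is at most a multiple of $r^{x-(y+1)p}\log(1/r)^{-p}$. The logarithm settles the
  -- borderline exponent $-1$ when $p>1$. Below $e^{-1}$ one has $\log(1/r)>1$.
  set g : ℝ → ℝ := (Set.Ioo 0 (Real.exp (-1))).indicator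
    fun r => r ^ (-(y + 1)) * (-Real.log r) ^ (-1 : ℝ) with hg
  refine ⟨g, ?_, ?_, ?_, ?_⟩
  · exact Measurable.indicator (by fun_prop) measurableSet_Ioo
  · intro r
    refine Set.indicator_nonneg (fun r hr => ?_) r
    have := hlog r hr
    have := hr.1
    positivity
  · have hfin := lintegral_rpow_mul_neg_log_rpow_lt_top hp h1 h2
    refine lt_of_le_of_lt (b := ENNReal.ofReal K * ∫⁻ r in Set.Ioo 0 (Real.exp (-1)),
      ENNReal.ofReal (r ^ (x - (y + 1) * p) * (-Real.log r) ^ (-p))) ?_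
      (ENNReal.mul_lt_top ENNReal.ofReal_lt_top hfin)
    rw [← lintegral_const_mul' _ _ ENNReal.ofReal_ne_top]
    refine le_trans ?_ (lintegral_indicator measurableSet_Ioo _).le
    refine (setLIntegral_le_lintegral _ _).trans (lintegral_mono fun r => ?_)
    by_cases hr : r ∈ Set.Ioo 0 (Real.exp (-1))
    · have hl := hlog r hr
      have hr0 := hr.1
      simp only [hg, Set.indicator_of_mem hr]
      rw [← ENNReal.ofReal_mul hK]
      refine ENNReal.ofReal_le_ofReal ?_
      rw [Real.mul_rpow (by positivity) (by positivity), ← Real.rpow_mul hr0.le,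
        ← Real.rpow_mul hl.le, show x - (y + 1) * p = x + -(y + 1) * p by ring,
        Real.rpow_add hr0, neg_one_mul]
      calc _ ≤ K * r ^ x * (r ^ (-(y + 1) * p) * (-Real.log r) ^ (-p)) := by
            gcongr
            exact hu r hr
        _ = _ := by ring
    · simp only [hg, Set.indicator_of_notMem hr]
      rw [Real.zero_rpow (by linarith), mul_zero, ENNReal.ofReal_zero]
  · rw [← top_le_iff]
    calc ∞ = ENNReal.ofReal k * ∞ := (ENNReal.mul_top (by simpa using hk)).symm
      _ = ∫⁻ r in Set.Ioo 0 (Real.exp (-1)), ENNReal.ofReal k *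
          ENNReal.ofReal (r⁻¹ * (-Real.log r) ^ (-1 : ℝ)) := by
          rw [lintegral_const_mul' _ _ ENNReal.ofReal_ne_top, lintegral_inv_mul_neg_log_inv]
      _ ≤ ∫⁻ r in Set.Ioo 0 (Real.exp (-1)), ENNReal.ofReal (v r * g r) := by
          refine setLIntegral_mono' measurableSet_Ioo fun r hr => ?_
          have hl := hlog r hr
          have hr0 := hr.1
          rw [← ENNReal.ofReal_mul hk.le]
          refine ENNReal.ofReal_le_ofReal ?_
          simp only [hg, Set.indicator_of_mem hr]
          calc k * (r⁻¹ * (-Real.log r) ^ (-1 : ℝ)) =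
                k * r ^ y * (r ^ (-(y + 1)) * (-Real.log r) ^ (-1 : ℝ)) := by
                rw [← Real.rpow_neg_one r, show (-1 : ℝ) = y + -(y + 1) by ring,
                  Real.rpow_add hr0, show y + -(y + 1) = -1 by ring]
                ring
            _ ≤ _ := by
                gcongr
                exact hv r hr
      _ ≤ _ := lintegral_mono_set hsub

theorem lintegral_Ioo_one_sub (F : ℝ → ℝ≥0∞) :
    ∫⁻ r in Set.Ioo (0 : ℝ) 1, F (1 - r) = ∫⁻ r in Set.Ioo (0 : ℝ) 1, F r := by
  have h := (Measure.measurePreserving_sub_left volume (1 : ℝ)).setLIntegral_comp_preimage_emb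
    (MeasurableEquiv.subLeft (1 : ℝ)).measurableEmbedding F (Set.Ioo 0 1)
  rw [← h]
  simp

/-! ### Necessity: convergence of the integrals -/

theorem ae_restrict_of_ae_mu {a b : ℝ} (ha : -1 < a) (hb : -1 < b) {P : ℂ → Prop}
    (h : ∀ᵐ z ∂(mu a b), P z) : ∀ᵐ z ∂((volume : Measure ℂ).restrict (Metric.ball 0 1)), P z := by
  refine (withDensity_absolutelyContinuous' (measurable_density a b).aemeasurable ?_).ae_le h
  have hB := ProbabilityTheory.beta_pos (α := a + 1) (β := b + 1) (by linarith) (by linarith)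
  have hpi := Real.pi_pos
  filter_upwards [ae_ball_ne_zero] with z hz
  have hz1 := one_sub_norm_sq_pos hz.1
  have hz0 : 0 < ‖z‖ := norm_pos_iff.2 hz.2
  exact (ENNReal.ofReal_pos.2 (by positivity)).ne'

theorem exists_mem_of_ae_mu {a b : ℝ} (ha : -1 < a) (hb : -1 < b) {P : ℂ → Prop}
    (h : ∀ᵐ z ∂(mu a b), P z) {U : Set ℂ} (hU : IsOpen U) (hne : U.Nonempty)
    (hsub : U ⊆ Metric.ball 0 1) : ∃ z ∈ U, P z := by
  have h1 := (ae_restrict_iff' Metric.isOpen_ball.measurableSet).1 (ae_restrict_of_ae_mu ha hb h)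
  obtain ⟨z, hz, hzU⟩ := (Measure.dense_of_ae h1).inter_open_nonempty U hU hne
  exact ⟨z, hz, hzU (hsub hz)⟩

theorem isFiniteMeasure_mu {a b : ℝ} (ha : -1 < a) (hb : -1 < b) : IsFiniteMeasure (mu a b) := by
  obtain ⟨c, hc, hmu⟩ := exists_lintegral_mu ha hb
  -- Used at $z=0$, where the denominator is $1$; the parameter $a+1$ only has to exceed $a$.
  obtain ⟨C, hC⟩ := forelli_rudin (c := 2 * b) ha (lt_add_one a) (by linarith)
  have h := hC 0 (by simp)
  refine ⟨?_⟩
  rw [← lintegral_one, hmu]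
  refine ENNReal.mul_lt_top ENNReal.ofReal_lt_top ?_
  simp only [zero_mul, sub_zero, norm_one, Real.one_rpow, div_one] at h
  simp only [mul_one]
  exact h.trans_lt (ENNReal.mul_lt_top ENNReal.coe_lt_top ENNReal.ofReal_lt_top)

namespace IsBergmanKernel

variable {α β a b : ℝ} {m : ℕ} {q φ : ℂ → ℂ} {κ : ℂ → ℂ → ℂ}

/-- Almost every $z$ is good, so one exists so close to $0$ that $|q(z\bar w)|\ge|q(0)|/2$ for all
$w$. As $|1-z\bar w|\le2$, the integrand there dominates a multiple of the stated one. -/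
theorem lintegral_lt_top_of_memLp (H : IsBergmanKernel α β a b m q φ κ) (ha : -1 < a) (hb : -1 < b)
    (hα : -1 < α) (hq : ContinuousOn q (Metric.closedBall 0 1)) (hq0 : q 0 ≠ 0) {p : ℝ≥0∞}
    (hT : IsBoundedOnLp (fun f z w => f w * κ z w) (fun f z => φ z * ∫ w, f w * κ z w ∂(mu a b))
      p (mu a b)) {f : ℂ → ℂ} (hf : MemLp f p (mu a b)) :
    ∫⁻ w in Metric.ball (0 : ℂ) 1,
      ENNReal.ofReal (‖w‖ ^ (2 * β - m) * (1 - ‖w‖ ^ 2) ^ α) * ‖f w‖ₑ < ∞ := by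
  obtain ⟨c, hc, hmu⟩ := exists_lintegral_mu ha hb
  obtain ⟨C, hC⟩ := hT
  have hε : 0 < ‖q 0‖ / 2 := by
    have := norm_pos_iff.2 hq0
    positivity
  have hqc : ContinuousAt q 0 := hq.continuousAt (Metric.closedBall_mem_nhds _ one_pos)
  obtain ⟨δ, hδ, hδq⟩ := Metric.eventually_nhds_iff_ball.1
    (hqc.norm.eventually (lt_mem_nhds (half_lt_self (norm_pos_iff.2 hq0))))
  obtain ⟨z, hzU, hz⟩ := exists_mem_of_ae_mu ha hb (hC f hf).1
    (U := Metric.ball 0 (min δ 1)) Metric.isOpen_ball (by simp [hδ])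
    (Metric.ball_subset_ball (min_le_right _ _))
  have hz1 : z ∈ Metric.ball (0 : ℂ) 1 := Metric.ball_subset_ball (min_le_right _ _) hzU
  have hzδ : ‖z‖ < δ := (mem_ball_zero_iff.1 hzU).trans_le (min_le_left _ _)
  have hfin := hz.2
  unfold HasFiniteIntegral at hfin
  rw [hmu] at hfin
  have hfin' := ENNReal.lt_top_of_mul_ne_top_right hfin.ne (by simpa using hc)
  set k : ℝ := ‖q 0‖ / 2 / 2 ^ (2 + α) with hk
  have hk0 : 0 < k := by positivity
  have hle : ENNReal.ofReal k * ∫⁻ w in Metric.ball (0 : ℂ) 1,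
      ENNReal.ofReal (‖w‖ ^ (2 * β - m) * (1 - ‖w‖ ^ 2) ^ α) * ‖f w‖ₑ ≤
      ∫⁻ w in Metric.ball (0 : ℂ) 1, ENNReal.ofReal (‖w‖ ^ (2 * b) * (1 - ‖w‖ ^ 2) ^ a) *
        ‖f w * κ z w‖ₑ := by
    rw [← lintegral_const_mul' _ _ ENNReal.ofReal_ne_top]
    refine lintegral_mono_ae ?_
    filter_upwards [ae_ball_ne_zero] with w hw
    have hw1 := one_sub_norm_sq_pos hw.1
    have hw0 : 0 < ‖w‖ := norm_pos_iff.2 hw.2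
    have hzw : ‖z * conj w‖ ≤ ‖z‖ := by
      rw [norm_mul, Complex.norm_conj]
      exact mul_le_of_le_one_right (norm_nonneg z) (mem_ball_zero_iff.1 hw.1).le
    have hqzw : ‖q 0‖ / 2 < ‖q (z * conj w)‖ := hδq _ (mem_ball_zero_iff.2 (hzw.trans_lt hzδ))
    have hd1 : ‖1 - z * conj w‖ ≤ 2 := by
      refine (norm_sub_le _ _).trans ?_
      rw [norm_one]
      linarith [mem_ball_zero_iff.1 hz1]
    have hd0 : 0 < ‖1 - z * conj w‖ := by
      have := norm_sub_norm_le (1 : ℂ) (z * conj w)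
      rw [norm_one] at this
      linarith [mem_ball_zero_iff.1 hz1]
    rw [enorm_mul, ← ofReal_norm (κ z w), mul_comm ‖f w‖ₑ, ← mul_assoc, ← mul_assoc,
      ← ENNReal.ofReal_mul hk0.le, ← ENNReal.ofReal_mul (by positivity)]
    gcongr ?_ * _
    refine ENNReal.ofReal_le_ofReal ?_
    rw [H.norm_right z hz1 w hw.1 hw.2]
    calc k * (‖w‖ ^ (2 * β - m) * (1 - ‖w‖ ^ 2) ^ α)
        = ‖w‖ ^ (2 * b) * (1 - ‖w‖ ^ 2) ^ a * (‖q 0‖ / 2 * (1 - ‖w‖ ^ 2) ^ (α - a) *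
          ‖w‖ ^ (2 * β - 2 * b - m) / 2 ^ (2 + α)) := by
          rw [show 2 * β - m = 2 * b + (2 * β - 2 * b - m) by ring, Real.rpow_add hw0, hk]
          rw [show (1 - ‖w‖ ^ 2) ^ α = (1 - ‖w‖ ^ 2) ^ a * (1 - ‖w‖ ^ 2) ^ (α - a) by
            rw [← Real.rpow_add hw1, add_sub_cancel]]
          ring
      _ ≤ _ := by
          have : 0 ≤ 2 + α := by linarith
          gcongr
  exact ENNReal.lt_top_of_mul_ne_top_right (hle.trans_lt hfin').ne (by simpa using hk0)

theorem radial_lintegral_lt_top (H : IsBergmanKernel α β a b m q φ κ) (ha : -1 < a) (hb : -1 < b)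
    (hα : -1 < α) (hq : ContinuousOn q (Metric.closedBall 0 1)) (hq0 : q 0 ≠ 0) {p : ℝ} (hp : 1 ≤ p)
    (hT : IsBoundedOnLp (fun f z w => f w * κ z w) (fun f z => φ z * ∫ w, f w * κ z w ∂(mu a b))
      (ENNReal.ofReal p) (mu a b)) {g : ℝ → ℝ} (hg : Measurable g) (hg0 : ∀ r, 0 ≤ g r)
    (hgp : ∫⁻ r in Set.Ioo (0 : ℝ) 1,
      ENNReal.ofReal (r ^ (2 * b + 1) * (1 - r ^ 2) ^ a * g r ^ p) < ∞) :
    ∫⁻ r in Set.Ioo (0 : ℝ) 1,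
      ENNReal.ofReal (r ^ (2 * β - m + 1) * (1 - r ^ 2) ^ α * g r) < ∞ := by
  obtain ⟨c, hc, hmu⟩ := exists_lintegral_mu ha hb
  have hp0 : 0 < p := by linarith
  have hn : ∀ w : ℂ, ‖((g ‖w‖ : ℝ) : ℂ)‖ₑ = ENNReal.ofReal (g ‖w‖) := fun w => by
    rw [← ofReal_norm, Complex.norm_real, Real.norm_eq_abs, abs_of_nonneg (hg0 _)]
  have hpi : ENNReal.ofReal (2 * Real.pi) ≠ 0 := by
    simpa using Real.pi_pos
  have hmem : MemLp (fun w : ℂ => ((g ‖w‖ : ℝ) : ℂ)) (ENNReal.ofReal p) (mu a b) := by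
    refine ⟨(by fun_prop : Measurable fun w : ℂ => ((g ‖w‖ : ℝ) : ℂ)).aestronglyMeasurable, ?_⟩
    rw [eLpNorm_lt_top_iff_lintegral_rpow_enorm_lt_top (ENNReal.ofReal_pos.2 hp0).ne'
      ENNReal.ofReal_ne_top, ENNReal.toReal_ofReal hp0.le, hmu]
    refine ENNReal.mul_lt_top ENNReal.ofReal_lt_top ?_
    simp only [hn]
    rw [lintegral_ball_radial (F := fun r => ENNReal.ofReal (r ^ (2 * b) * (1 - r ^ 2) ^ a) *
      ENNReal.ofReal (g r) ^ p) (by fun_prop)]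
    refine ENNReal.mul_lt_top ENNReal.ofReal_lt_top (lt_of_le_of_lt (le_of_eq ?_) hgp)
    refine setLIntegral_congr_fun measurableSet_Ioo fun r hr => ?_
    have hr0 := hr.1
    have hr1 : 0 < 1 - r ^ 2 := by nlinarith [hr.2]
    have := hg0 r
    rw [ENNReal.ofReal_rpow_of_nonneg (hg0 r) hp0.le, ← ENNReal.ofReal_mul (by positivity),
      ← ENNReal.ofReal_mul hr0.le, Real.rpow_add_one hr0.ne']
    congr 1
    ring
  have h := H.lintegral_lt_top_of_memLp ha hb hα hq hq0 hT hmem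
  simp only [hn] at h
  rw [lintegral_ball_radial (F := fun r => ENNReal.ofReal (r ^ (2 * β - m) * (1 - r ^ 2) ^ α) *
      ENNReal.ofReal (g r)) (by fun_prop)] at h
  refine lt_of_le_of_lt (le_of_eq ?_) (ENNReal.lt_top_of_mul_ne_top_right h.ne hpi)
  refine setLIntegral_congr_fun measurableSet_Ioo fun r hr => ?_
  have hr0 := hr.1
  have hr1 : 0 < 1 - r ^ 2 := by nlinarith [hr.2]
  have := hg0 r
  rw [← ENNReal.ofReal_mul (by positivity),
    ← ENNReal.ofReal_mul hr0.le, Real.rpow_add_one hr0.ne']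
  congr 1
  ring

/-- If it failed, `exists_test_function` would give a radial $L^p$ function with divergent integral.
Near $0$ the weights behave like $r^{2b+1}$ and $r^{2\beta-m+1}$, the extra $1$ being the polar
Jacobian. -/
theorem exponent_lt_at_zero (H : IsBergmanKernel α β a b m q φ κ) (ha : -1 < a) (hb : -1 < b)
    (hα : -1 < α) (hq : ContinuousOn q (Metric.closedBall 0 1)) (hq0 : q 0 ≠ 0) {p : ℝ} (hp : 1 ≤ p)
    (hT : IsBoundedOnLp (fun f z w => f w * κ z w) (fun f z => φ z * ∫ w, f w * κ z w ∂(mu a b))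
      (ENNReal.ofReal p) (mu a b)) :
    2 * b + 2 < (2 * β - m + 2) * p ∨ p = 1 ∧ 2 * b + 2 ≤ (2 * β - m + 2) * p := by
  by_contra! hcon
  have hb1 : ∀ r ∈ Set.Ioo 0 (Real.exp (-1)), 1 - Real.exp (-1) ^ 2 ≤ 1 - r ^ 2 := fun r hr => by
    have := hr.1
    have := hr.2.le
    gcongr
  have hl : 0 < 1 - Real.exp (-1) ^ 2 := by
    have : Real.exp (-1) < 1 := Real.exp_lt_one_iff.2 (by norm_num)
    nlinarith [Real.exp_pos (-1)]
  obtain ⟨g, hg, hg0, h1, h2⟩ := exists_test_function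
    (u := fun r => r ^ (2 * b + 1) * (1 - r ^ 2) ^ a)
    (v := fun r => r ^ (2 * β - m + 1) * (1 - r ^ 2) ^ α) (x := 2 * b + 1) (y := 2 * β - m + 1)
    (K := (1 - Real.exp (-1) ^ 2) ^ a + 1 ^ a)
    (k := ((1 - Real.exp (-1) ^ 2) ^ (-α) + 1 ^ (-α))⁻¹) hp (by positivity) (by positivity)
    (fun r hr => by
      rw [mul_comm]
      exact mul_le_mul_of_nonneg_right (rpow_le_rpow_add_rpow a hl (hb1 r hr) (by nlinarith))
        (Real.rpow_nonneg hr.1.le _))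
    (fun r hr => by
      rw [mul_comm]
      exact mul_le_mul_of_nonneg_left (inv_add_le_rpow α hl (hb1 r hr) (by nlinarith))
        (Real.rpow_nonneg hr.1.le _))
    (by linarith [hcon.1]) (fun h => by linarith [hcon.2 h])
  exact (H.radial_lintegral_lt_top ha hb hα hq hq0 hp hT hg hg0 h1).ne h2

/-- The same argument at the unit circle: after $r\mapsto1-r$ the weights behave like $r^a$ and
$r^\alpha$. -/
theorem exponent_lt_at_one (H : IsBergmanKernel α β a b m q φ κ) (ha : -1 < a) (hb : -1 < b)
    (hα : -1 < α) (hq : ContinuousOn q (Metric.closedBall 0 1)) (hq0 : q 0 ≠ 0) {p : ℝ} (hp : 1 ≤ p)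
    (hT : IsBoundedOnLp (fun f z w => f w * κ z w) (fun f z => φ z * ∫ w, f w * κ z w ∂(mu a b))
      (ENNReal.ofReal p) (mu a b)) :
    a + 1 < (α + 1) * p ∨ p = 1 ∧ a + 1 ≤ (α + 1) * p := by
  by_contra! hcon
  have hl : 0 < 1 - Real.exp (-1) := by
    have : Real.exp (-1) < 1 := Real.exp_lt_one_iff.2 (by norm_num)
    linarith
  have hfac : ∀ r ∈ Set.Ioo 0 (Real.exp (-1)), ∀ e : ℝ,
      (1 - (1 - r) ^ 2) ^ e = r ^ e * (2 - r) ^ e := fun r hr e => by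
    have : r < 1 := by linarith [hr.2]
    rw [← Real.mul_rpow hr.1.le (by linarith)]
    ring_nf
  obtain ⟨g, hg, hg0, h1, h2⟩ := exists_test_function
    (u := fun r => (1 - r) ^ (2 * b + 1) * (1 - (1 - r) ^ 2) ^ a)
    (v := fun r => (1 - r) ^ (2 * β - m + 1) * (1 - (1 - r) ^ 2) ^ α) (x := a) (y := α)
    (K := ((1 - Real.exp (-1)) ^ (2 * b + 1) + 1 ^ (2 * b + 1)) * (1 ^ a + 2 ^ a))
    (k := ((1 - Real.exp (-1)) ^ (-(2 * β - m + 1)) + 1 ^ (-(2 * β - m + 1)))⁻¹ *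
      (1 ^ (-α) + 2 ^ (-α))⁻¹) hp (by positivity) (by positivity)
    (fun r hr => by
      have hr0 := hr.1
      have hr1 : r < Real.exp (-1) := hr.2
      have : 0 ≤ 2 - r := by linarith
      rw [hfac r hr]
      calc _ = (1 - r) ^ (2 * b + 1) * (2 - r) ^ a * r ^ a := by ring
        _ ≤ _ := by
          gcongr
          · exact rpow_le_rpow_add_rpow _ hl (by linarith) (by linarith)
          · exact rpow_le_rpow_add_rpow _ one_pos (by linarith) (by linarith))
    (fun r hr => by
      have hr0 := hr.1
      have hr1 : r < Real.exp (-1) := hr.2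
      have : 0 ≤ 1 - r := by linarith
      rw [hfac r hr]
      calc _ ≤ (1 - r) ^ (2 * β - m + 1) * (2 - r) ^ α * r ^ α := by
            gcongr
            · exact inv_add_le_rpow _ hl (by linarith) (by linarith)
            · exact inv_add_le_rpow _ one_pos (by linarith) (by linarith)
        _ = _ := by ring)
    (by linarith [hcon.1]) (fun h => by linarith [hcon.2 h])
  have h3 := H.radial_lintegral_lt_top ha hb hα hq hq0 hp hT (g := fun r => g (1 - r))
    (by fun_prop) (fun r => hg0 _) (by
      rw [← lintegral_Ioo_one_sub]
      simpa using h1)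
  rw [← lintegral_Ioo_one_sub] at h3
  simp only [sub_sub_cancel] at h3
  exact h3.ne h2

end IsBergmanKernel

/-! ### Necessity: behaviour of the output -/

namespace IsBergmanKernel

variable {α β a b : ℝ} {m : ℕ} {q φ : ℂ → ℂ} {κ : ℂ → ℂ → ℂ}

theorem norm_zero_right (H : IsBergmanKernel α β a b m q φ κ) {w : ℂ}
    (hw : w ∈ Metric.ball (0 : ℂ) 1) (hw0 : w ≠ 0) :
    ‖κ 0 w‖ = ‖q 0‖ * (1 - ‖w‖ ^ 2) ^ (α - a) * ‖w‖ ^ (2 * β - 2 * b - m) := by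
  rw [H.norm_right 0 (by simp) w hw hw0]
  simp

/-- A function in every `L^p` whose image under the operator behaves like `‖z‖^{-m}` at `0`. -/
theorem exists_image_ge (H : IsBergmanKernel α β a b m q φ κ) (ha : -1 < a) (hb : -1 < b)
    (hα : -1 < α) (hq : ContinuousOn q (Metric.closedBall 0 1)) (hq0 : q 0 ≠ 0) (p : ℝ≥0∞) :
    ∃ f : ℂ → ℂ, MemLp f p (mu a b) ∧ ∃ ε > 0, ∃ ρ > 0, ∀ z ∈ Metric.ball (0 : ℂ) ρ,
      ε ≤ ‖∫ w, f w * κ z w ∂(mu a b)‖ := by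
  have := isFiniteMeasure_mu ha hb
  obtain ⟨M, hM⟩ := (isCompact_closedBall (0 : ℂ) 1).exists_bound_of_continuousOn hq
  have hM0 : 0 ≤ M := (norm_nonneg _).trans (hM 0 (by simp))
  have hqp : 0 < ‖q 0‖ := norm_pos_iff.2 hq0
  -- On this annulus $|w|$ and $1-|w|^2$ are bounded away from $0$, so every power in the kernel is
  -- bounded above and below.
  set S : Set ℂ := Metric.ball 0 (1 / 2) ∩ (Metric.closedBall 0 (1 / 4))ᶜ with hS
  have hSo : IsOpen S := Metric.isOpen_ball.inter Metric.isClosed_closedBall.isOpen_compl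
  have hS1 : ∀ w ∈ S, 1 / 4 < ‖w‖ ∧ ‖w‖ < 1 / 2 := fun w hw => by
    simpa [hS, and_comm] using hw
  have hSb : S ⊆ Metric.ball 0 1 := fun w hw => by
    rw [mem_ball_zero_iff]
    linarith [(hS1 w hw).2]
  have hSne : S.Nonempty := ⟨((3 / 8 : ℝ) : ℂ), by
    simp only [hS, Set.mem_inter_iff, mem_ball_zero_iff, Set.mem_compl_iff,
      mem_closedBall_zero_iff, Complex.norm_real, Real.norm_eq_abs]
    norm_num⟩
  have hS0 : ∀ w ∈ S, w ≠ 0 := fun w hw => norm_pos_iff.1 (by linarith [(hS1 w hw).1])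
  have hκ0 : ∀ w ∈ S, κ 0 w ≠ 0 := fun w hw => by
    have h1 := one_sub_norm_sq_pos (hSb hw)
    have h2 : 0 < ‖w‖ := norm_pos_iff.2 (hS0 w hw)
    rw [← norm_pos_iff, H.norm_zero_right (hSb hw) (hS0 w hw)]
    positivity
  -- Inverting the kernel removes its unknown phase: at $z=0$ the integral is $\mu(S)>0$, and
  -- continuity keeps it away from $0$ nearby.
  set f : ℂ → ℂ := S.indicator fun w => (κ 0 w)⁻¹ with hf
  have hκm : Measurable (κ 0) := H.measurable_right.comp measurable_prodMk_left
  have hfm : Measurable f := Measurable.indicator hκm.inv hSo.measurableSet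
  have hmem : MemLp f p (mu a b) := by
    refine MemLp.of_bound hfm.aestronglyMeasurable
      (‖q 0‖⁻¹ * ((1 / 2 : ℝ) ^ (-(α - a)) + 1 ^ (-(α - a))) *
        ((1 / 4 : ℝ) ^ (-(2 * β - 2 * b - m)) + (1 / 2 : ℝ) ^ (-(2 * β - 2 * b - m))))
      (Filter.Eventually.of_forall fun w => ?_)
    by_cases hw : w ∈ S
    · have h1 := one_sub_norm_sq_pos (hSb hw)
      have h2 : 0 < ‖w‖ := norm_pos_iff.2 (hS0 w hw)
      have h3 := hS1 w hw
      rw [hf, Set.indicator_of_mem hw, norm_inv, H.norm_zero_right (hSb hw) (hS0 w hw), mul_inv,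
        mul_inv, ← Real.rpow_neg h1.le, ← Real.rpow_neg h2.le]
      gcongr
      · exact rpow_le_rpow_add_rpow _ (by norm_num) (by nlinarith) (by nlinarith)
      · exact rpow_le_rpow_add_rpow _ (by norm_num) h3.1.le h3.2.le
    · rw [hf, Set.indicator_of_notMem hw, norm_zero]
      positivity
  have hcont : ContinuousAt (fun z => ∫ w, f w * κ z w ∂(mu a b)) 0 := by
    refine continuousAt_of_dominated (bound := fun _ => ‖q 0‖⁻¹ * (M / (1 / 2) ^ (2 + α)))
      (Filter.Eventually.of_forall fun z => (hfm.mul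
        (H.measurable_right.comp measurable_prodMk_left)).aestronglyMeasurable) ?_
      (integrable_const _) (Filter.Eventually.of_forall fun w => ?_)
    · filter_upwards [Metric.ball_mem_nhds (0 : ℂ) (by norm_num : (0 : ℝ) < 1 / 2)] with z hz
      refine Filter.Eventually.of_forall fun w => ?_
      rw [mem_ball_zero_iff] at hz
      by_cases hw : w ∈ S
      · have h1 := one_sub_norm_sq_pos (hSb hw)
        have h2 : 0 < ‖w‖ := norm_pos_iff.2 (hS0 w hw)
        have hz1 : z ∈ Metric.ball (0 : ℂ) 1 := by rw [mem_ball_zero_iff]; linarith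
        have hqb := hM _ (Metric.ball_subset_closedBall
          (mul_conj_mem_ball hz1 (Metric.ball_subset_closedBall (hSb hw))))
        have hd : 1 / 2 ≤ ‖1 - z * conj w‖ := by
          have h3 := norm_sub_norm_le (1 : ℂ) (z * conj w)
          rw [norm_one, norm_mul, Complex.norm_conj] at h3
          nlinarith [(hS1 w hw).2, norm_nonneg z]
        have h4 : 0 ≤ 2 + α := by linarith
        rw [hf, Set.indicator_of_mem hw, norm_mul, norm_inv,
          H.norm_zero_right (hSb hw) (hS0 w hw), H.norm_right z hz1 w (hSb hw) (hS0 w hw)]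
        calc _ = ‖q 0‖⁻¹ * (‖q (z * conj w)‖ / ‖1 - z * conj w‖ ^ (2 + α)) := by
              have h5 : (1 - ‖w‖ ^ 2) ^ (α - a) ≠ 0 := (Real.rpow_pos_of_pos h1 _).ne'
              have h6 : ‖w‖ ^ (2 * β - 2 * b - m) ≠ 0 := (Real.rpow_pos_of_pos h2 _).ne'
              field_simp
          _ ≤ _ := by gcongr
      · rw [hf, Set.indicator_of_notMem hw, zero_mul, norm_zero]
        positivity
    · by_cases hw : w ∈ S
      · exact continuousAt_const.mul (H.continuousAt_zero w (hSb hw))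
      · simp only [hf, Set.indicator_of_notMem hw, zero_mul]
        exact continuousAt_const
  have hval : ∫ w, f w * κ 0 w ∂(mu a b) = ((mu a b).real S : ℂ) := by
    have : (fun w => f w * κ 0 w) = S.indicator fun _ => (1 : ℂ) := by
      funext w
      by_cases hw : w ∈ S
      · rw [hf, Set.indicator_of_mem hw, Set.indicator_of_mem hw, inv_mul_cancel₀ (hκ0 w hw)]
      · rw [hf, Set.indicator_of_notMem hw, Set.indicator_of_notMem hw, zero_mul]
    rw [this, integral_indicator hSo.measurableSet, setIntegral_const]
    simp
  have hpos : 0 < (mu a b).real S := by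
    refine ENNReal.toReal_pos (fun h0 => ?_) (measure_ne_top _ _)
    obtain ⟨z, hz, hz'⟩ := exists_mem_of_ae_mu ha hb (measure_eq_zero_iff_ae_notMem.1 h0) hSo hSne
      hSb
    exact hz' hz
  have hev := hcont.norm.eventually (lt_mem_nhds (a := (mu a b).real S / 2) (by
    beta_reduce
    rw [hval, Complex.norm_real, Real.norm_eq_abs, abs_of_pos hpos]
    exact half_lt_self hpos))
  obtain ⟨ρ, hρ, hρ'⟩ := Metric.eventually_nhds_iff_ball.1 hev
  exact ⟨f, hmem, _, half_pos hpos, ρ, hρ, fun z hz => (hρ' z hz).le⟩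

/-- Some image is at least $\varepsilon|z|^{-m}$ near $0$; membership in $L^p$ forces $r^{2b-pm+1}$
to be integrable at $0$. -/
theorem exponent_gt_at_zero (H : IsBergmanKernel α β a b m q φ κ) (ha : -1 < a) (hb : -1 < b)
    (hα : -1 < α) (hq : ContinuousOn q (Metric.closedBall 0 1)) (hq0 : q 0 ≠ 0) {p : ℝ} (hp : 1 ≤ p)
    (hT : IsBoundedOnLp (fun f z w => f w * κ z w) (fun f z => φ z * ∫ w, f w * κ z w ∂(mu a b))
      (ENNReal.ofReal p) (mu a b)) : p * m - 2 < 2 * b := by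
  obtain ⟨c, hc, hmu⟩ := exists_lintegral_mu ha hb
  obtain ⟨C, hC⟩ := hT
  obtain ⟨f, hf, ε, hε, ρ, hρ, hfρ⟩ := H.exists_image_ge ha hb hα hq hq0 (ENNReal.ofReal p)
  have hp0 : 0 < p := by linarith
  have hTf := (hC f hf).2.1.2
  rw [eLpNorm_lt_top_iff_lintegral_rpow_enorm_lt_top (ENNReal.ofReal_pos.2 hp0).ne'
    ENNReal.ofReal_ne_top, ENNReal.toReal_ofReal hp0.le, hmu] at hTf
  have hfin := ENNReal.lt_top_of_mul_ne_top_right hTf.ne (by simpa using hc)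
  set δ : ℝ := min ρ (1 / 2) with hδ
  have hδ0 : 0 < δ := lt_min hρ (by norm_num)
  set k : ℝ := ((1 / 2 : ℝ) ^ (-a) + 1 ^ (-a))⁻¹ * ε ^ p with hk
  have hk0 : 0 < k := by positivity
  have hlow : ∫⁻ z in Metric.ball (0 : ℂ) 1, (Set.Ioo 0 δ).indicator
        (fun r => ENNReal.ofReal (k * r ^ (2 * b - p * m))) ‖z‖ < ∞ := by
    refine lt_of_le_of_lt (lintegral_mono_ae ?_) hfin
    filter_upwards [ae_ball_ne_zero] with z hz
    have hz1 := one_sub_norm_sq_pos hz.1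
    have hz0 : 0 < ‖z‖ := norm_pos_iff.2 hz.2
    by_cases hzδ : ‖z‖ ∈ Set.Ioo 0 δ
    · have h1 := hfρ z (mem_ball_zero_iff.2 (hzδ.2.trans_le (min_le_left _ _)))
      have h2 : ‖z‖ < 1 / 2 := hzδ.2.trans_le (min_le_right _ _)
      rw [Set.indicator_of_mem hzδ, ← ofReal_norm, ENNReal.ofReal_rpow_of_nonneg (norm_nonneg _)
        hp0.le, ← ENNReal.ofReal_mul (by positivity)]
      refine ENNReal.ofReal_le_ofReal ?_
      rw [norm_mul, H.norm_left z hz.2]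
      have h3 := inv_add_le_rpow a (l := 1 / 2) (u := 1) (x := 1 - ‖z‖ ^ 2) (by norm_num)
        (by nlinarith) (by nlinarith)
      calc k * ‖z‖ ^ (2 * b - p * m) = ‖z‖ ^ (2 * b) * ((1 / 2 : ℝ) ^ (-a) + 1 ^ (-a))⁻¹ *
            (‖z‖ ^ (-(m : ℝ)) * ε) ^ p := by
            rw [Real.mul_rpow (by positivity) hε.le, ← Real.rpow_mul hz0.le,
              show 2 * b - p * m = 2 * b + -(m : ℝ) * p by ring, Real.rpow_add hz0, hk]
            ring
        _ ≤ _ := by gcongr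
    · rw [Set.indicator_of_notMem hzδ]
      exact zero_le
  rw [lintegral_ball_radial (Measurable.indicator (by fun_prop) measurableSet_Ioo)] at hlow
  have h1 := ENNReal.lt_top_of_mul_ne_top_right hlow.ne (by simpa using Real.pi_pos)
  have h2 : ENNReal.ofReal k * ∫⁻ r in Set.Ioo 0 δ, ENNReal.ofReal (r ^ (2 * b - p * m + 1)) < ∞ := by
    refine lt_of_le_of_lt ?_ h1
    rw [← lintegral_const_mul' _ _ ENNReal.ofReal_ne_top]
    refine le_trans (setLIntegral_mono' measurableSet_Ioo fun r hr => ?_)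
      (lintegral_mono_set (Set.Ioo_subset_Ioo_right
        ((min_le_right ρ (1 / 2)).trans (by norm_num : (1 / 2 : ℝ) ≤ 1))))
    have hr0 := hr.1
    rw [Set.indicator_of_mem hr, ← ENNReal.ofReal_mul hk0.le, ← ENNReal.ofReal_mul hr0.le,
      Real.rpow_add_one hr0.ne']
    exact ENNReal.ofReal_le_ofReal (by linarith)
  have h3 := neg_one_lt_of_lintegral_Ioo_rpow_lt_top hδ0
    (ENNReal.lt_top_of_mul_ne_top_right h2.ne (by simpa using hk0))
  linarith

/-- Normalized indicators of sets shrinking to $w=1$ have norm $1$ in $L^1$, and their images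
converge pointwise to $\varphi(z)\kappa(z,1)$ by continuity of $\kappa(z,\cdot)$ at $1$. Fatou
transfers the uniform bound to the limit. -/
theorem lintegral_mul_one_lt_top (H : IsBergmanKernel α β a b m q φ κ) (ha : -1 < a) (hb : -1 < b)
    (hαa : α = a) (hT : IsBoundedOnLp (fun f z w => f w * κ z w)
      (fun f z => φ z * ∫ w, f w * κ z w ∂(mu a b)) 1 (mu a b)) :
    ∫⁻ z, ‖φ z * κ z 1‖ₑ ∂(mu a b) < ∞ := by
  have := isFiniteMeasure_mu ha hb
  obtain ⟨C, hC⟩ := hT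
  set S : ℕ → Set ℂ := fun n => Metric.ball 0 1 ∩ Metric.ball 1 (1 / ((n : ℝ) + 1)) with hS
  have hSo : ∀ n, IsOpen (S n) := fun n => Metric.isOpen_ball.inter Metric.isOpen_ball
  have hSne : ∀ n, (S n).Nonempty := fun n => by
    have hn : (0 : ℝ) ≤ n := Nat.cast_nonneg n
    have h1 : 0 < 1 / ((n : ℝ) + 2) := by positivity
    have h2 : 1 / ((n : ℝ) + 2) < 1 / ((n : ℝ) + 1) :=
      one_div_lt_one_div_of_lt (by positivity) (by linarith)
    have h3 : 1 / ((n : ℝ) + 2) ≤ 1 := by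
      rw [div_le_one (by positivity)]
      linarith
    refine ⟨((1 - 1 / ((n : ℝ) + 2) : ℝ) : ℂ), ?_, ?_⟩
    · rw [mem_ball_zero_iff, Complex.norm_real, Real.norm_eq_abs, abs_of_nonneg (by linarith)]
      linarith
    · rw [mem_ball_iff_norm, ← Complex.ofReal_one, ← Complex.ofReal_sub, Complex.norm_real,
        Real.norm_eq_abs, sub_sub_cancel_left, abs_neg, abs_of_pos h1]
      exact h2
  have hpos : ∀ n, 0 < (mu a b).real (S n) := fun n => by
    refine ENNReal.toReal_pos (fun h0 => ?_) (measure_ne_top _ _)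
    obtain ⟨z, hz, hz'⟩ := exists_mem_of_ae_mu ha hb (measure_eq_zero_iff_ae_notMem.1 h0) (hSo n)
      (hSne n) Set.inter_subset_left
    exact hz' hz
  set f : ℕ → ℂ → ℂ := fun n => (S n).indicator fun _ => (((mu a b).real (S n) : ℂ))⁻¹ with hf
  have hmem : ∀ n, MemLp (f n) 1 (mu a b) := fun n =>
    memLp_indicator_const 1 (hSo n).measurableSet _ (Or.inr (measure_ne_top _ _))
  have hnorm : ∀ n, eLpNorm (f n) 1 (mu a b) = 1 := fun n => by
    rw [hf, eLpNorm_indicator_const (hSo n).measurableSet one_ne_zero ENNReal.one_ne_top,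
      ← ofReal_norm, norm_inv, Complex.norm_real, Real.norm_eq_abs, abs_of_pos (hpos n),
      ENNReal.ofReal_inv_of_pos (hpos n), measureReal_def, ENNReal.ofReal_toReal (measure_ne_top _ _)]
    simp only [ENNReal.toReal_one, div_one, ENNReal.rpow_one]
    exact ENNReal.inv_mul_cancel (fun h => (hpos n).ne' (by simp [measureReal_def, h]))
      (measure_ne_top _ _)
  have hval : ∀ n z, ∫ w, f n w * κ z w ∂(mu a b) =
      (((mu a b).real (S n) : ℂ))⁻¹ * ∫ w in S n, κ z w ∂(mu a b) := fun n z => by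
    rw [← integral_const_mul, ← integral_indicator (hSo n).measurableSet]
    refine integral_congr_ae (Filter.Eventually.of_forall fun w => ?_)
    by_cases hw : w ∈ S n <;> simp [hf, hw]
  have hsmall : Filter.Tendsto S Filter.atTop (nhdsWithin (1 : ℂ) (Metric.ball 0 1)).smallSets := by
    rw [Filter.tendsto_smallSets_iff]
    intro t ht
    obtain ⟨ε, hε, hεt⟩ := Metric.mem_nhdsWithin_iff.1 ht
    have hlim := (tendsto_one_div_add_atTop_nhds_zero_nat (𝕜 := ℝ)).eventually (gt_mem_nhds hε)
    filter_upwards [hlim] with n hn w hw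
    exact hεt ⟨Metric.ball_subset_ball hn.le hw.2, hw.1⟩
  have hlim : ∀ z ∈ Metric.ball (0 : ℂ) 1, Filter.Tendsto
      (fun n => φ z * ∫ w, f n w * κ z w ∂(mu a b)) Filter.atTop (nhds (φ z * κ z 1)) := by
    intro z hz
    have hκm : Measurable (κ z) := H.measurable_right.comp measurable_prodMk_left
    have h1 := (H.continuousWithinAt_one hαa z hz).integral_sub_linear_isLittleO_ae
      (μ := mu a b) Metric.isOpen_ball.measurableSet
      ⟨_, Filter.univ_mem, hκm.aestronglyMeasurable⟩ hsmall
    refine Filter.Tendsto.const_mul _ ?_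
    have h2 := h1.norm_left.tendsto_div_nhds_zero
    rw [tendsto_iff_norm_sub_tendsto_zero]
    refine h2.congr fun n => ?_
    have h3 : ((mu a b).real (S n) : ℂ) ≠ 0 := Complex.ofReal_ne_zero.2 (hpos n).ne'
    rw [hval, div_eq_inv_mul, show ((mu a b).real (S n))⁻¹ = ‖(((mu a b).real (S n) : ℂ))⁻¹‖ by
      rw [norm_inv, Complex.norm_real, Real.norm_eq_abs, abs_of_pos (hpos n)], ← norm_mul, mul_sub,
      Complex.real_smul, inv_mul_cancel_left₀ h3]
  calc ∫⁻ z, ‖φ z * κ z 1‖ₑ ∂(mu a b)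
      = ∫⁻ z, Filter.liminf (fun n => ‖φ z * ∫ w, f n w * κ z w ∂(mu a b)‖ₑ) Filter.atTop
          ∂(mu a b) := by
        refine lintegral_congr_ae ?_
        filter_upwards [ae_mu_mem a b] with z hz
        exact ((hlim z hz.1).enorm.liminf_eq).symm
    _ ≤ Filter.liminf (fun n => ∫⁻ z, ‖φ z * ∫ w, f n w * κ z w ∂(mu a b)‖ₑ ∂(mu a b))
          Filter.atTop :=
        lintegral_liminf_le' fun n => (hC (f n) (hmem n)).2.1.1.enorm
    _ ≤ Filter.liminf (fun _ : ℕ => (C : ℝ≥0∞)) Filter.atTop := by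
        refine Filter.liminf_le_liminf (Filter.Eventually.of_forall fun n => ?_)
        have h := (hC (f n) (hmem n)).2.2
        rwa [eLpNorm_one_eq_lintegral_enorm, hnorm, mul_one] at h
    _ = C := Filter.liminf_const _
    _ < ∞ := ENNReal.coe_lt_top

/-- On the sector $0<\theta<1-r$ near $1$ one has $|1-z|\le2(1-r)$, so the integrand is at least a
multiple of $(1-r)^{a-(2+\alpha)}=(1-r)^{-2}$. Integrating over $\theta$ leaves $(1-r)^{-1}$, which
diverges. -/
theorem lintegral_mul_one_eq_top (H : IsBergmanKernel α β a b m q φ κ) (ha : -1 < a) (hb : -1 < b)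
    (hαa : α = a) (hqm : Measurable q) (hq : ContinuousOn q (Metric.closedBall 0 1))
    (hq1 : q 1 ≠ 0) : ∫⁻ z, ‖φ z * κ z 1‖ₑ ∂(mu a b) = ∞ := by
  obtain ⟨c, hc, hmu⟩ := exists_lintegral_mu ha hb
  have hqp : 0 < ‖q 1‖ := norm_pos_iff.2 hq1
  have hα : 0 < 2 + α := by linarith
  obtain ⟨η, hη, hqη⟩ := Metric.mem_nhdsWithin_iff.1
    ((hq 1 (by simp)).norm.eventually (lt_mem_nhds (half_lt_self hqp)))
  -- For $1-r<\delta$ the bound $|1-z|\le2(1-r)<\eta$ gives $|q(z)|>|q(1)|/2$, and $r>1/2$ keeps the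
  -- power of $r$ under control.
  set δ : ℝ := min (η / 2) (1 / 2) with hδ
  have hδ0 : 0 < δ := lt_min (half_pos hη) (by norm_num)
  have hδ1 : δ ≤ 1 / 2 := min_le_right _ _
  have hδη : 2 * δ ≤ η := by linarith [min_le_left (η / 2) (1 / 2)]
  set k : ℝ := ((1 / 2 : ℝ) ^ (-(2 * b - m)) + 1 ^ (-(2 * b - m)))⁻¹ *
    ((1 : ℝ) ^ (-a) + 2 ^ (-a))⁻¹ * (‖q 1‖ / 2) / 2 ^ (2 + α) * (1 / 2) with hk
  have hk0 : 0 < k := by positivity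
  set G : ℂ → ℝ≥0∞ := fun z => ENNReal.ofReal (‖z‖ ^ (2 * b - m) * (1 - ‖z‖ ^ 2) ^ a *
    (‖q z‖ / ‖1 - z‖ ^ (2 + α))) with hG
  have hGm : Measurable G := by fun_prop
  have hcongr : ∫⁻ z, ‖φ z * κ z 1‖ₑ ∂(mu a b) =
      ENNReal.ofReal c * ∫⁻ z in Metric.ball (0 : ℂ) 1, G z := by
    rw [hmu]
    congr 1
    refine lintegral_congr_ae ?_
    filter_upwards [ae_ball_ne_zero] with z hz
    have hz1 := one_sub_norm_sq_pos hz.1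
    have hz0 : 0 < ‖z‖ := norm_pos_iff.2 hz.2
    rw [← ofReal_norm, ← ENNReal.ofReal_mul (by positivity), norm_mul, H.norm_left z hz.2,
      H.norm_right_one hαa z hz.1, hG]
    simp only
    rw [sub_eq_add_neg (2 * b), Real.rpow_add hz0]
    congr 1
    ring
  have hbound : ∀ r ∈ Set.Ioo (1 - δ) 1, ∀ θ ∈ Set.Ioo 0 (1 - r),
      k * (1 - r) ^ (-2 : ℝ) ≤ r * (‖(r : ℂ) * Complex.exp (θ * Complex.I)‖ ^ (2 * b - m) *
        (1 - ‖(r : ℂ) * Complex.exp (θ * Complex.I)‖ ^ 2) ^ a *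
        (‖q (r * Complex.exp (θ * Complex.I))‖ /
          ‖1 - (r : ℂ) * Complex.exp (θ * Complex.I)‖ ^ (2 + α))) := by
    intro r hr θ hθ
    have hr0 : 1 / 2 < r := by linarith [hr.1]
    have hr1 : r < 1 := hr.2
    have hrp : 0 < r := by linarith
    have h1r : 0 < 1 - r := by linarith
    have hn : ‖(r : ℂ) * Complex.exp (θ * Complex.I)‖ = r := by
      simp [Complex.norm_exp_ofReal_mul_I, abs_of_pos hrp]
    set z : ℂ := (r : ℂ) * Complex.exp (θ * Complex.I) with hz
    have hd : ‖1 - z‖ ≤ 2 * (1 - r) := by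
      have h1 : 1 - z = ((1 - r : ℝ) : ℂ) - r * (Complex.exp (Complex.I * θ) - 1) := by
        rw [hz, mul_comm Complex.I]
        push_cast
        ring
      rw [h1]
      refine (norm_sub_le _ _).trans ?_
      rw [Complex.norm_real, Real.norm_eq_abs, abs_of_pos h1r, norm_mul, Complex.norm_real,
        Real.norm_eq_abs, abs_of_pos hrp]
      have h2 := Real.norm_exp_I_mul_ofReal_sub_one_le (x := θ)
      rw [Real.norm_eq_abs, abs_of_pos hθ.1] at h2
      nlinarith [hθ.2, hθ.1, norm_nonneg (Complex.exp (Complex.I * θ) - 1)]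
    have hd0 : 0 < ‖1 - z‖ := by
      have h1 := norm_sub_norm_le (1 : ℂ) z
      rw [norm_one, hn] at h1
      linarith
    have hqz : ‖q 1‖ / 2 < ‖q z‖ := by
      refine hqη ⟨?_, ?_⟩
      · rw [Metric.mem_ball, dist_comm, dist_eq_norm]
        linarith [hr.1]
      · rw [mem_closedBall_zero_iff, hn]
        exact hr1.le
    have hfac : (1 - r ^ 2) ^ a = (1 - r) ^ a * (1 + r) ^ a := by
      rw [← Real.mul_rpow h1r.le (by linarith)]
      ring_nf
    rw [hn, hfac]
    have e1 := inv_add_le_rpow (2 * b - m) (l := 1 / 2) (u := 1) (by norm_num) hr0.le hr1.le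
    have e2 := inv_add_le_rpow a (l := 1) (u := 2) (x := 1 + r) one_pos (by linarith) (by linarith)
    calc k * (1 - r) ^ (-2 : ℝ) = 1 / 2 *
          (((1 / 2 : ℝ) ^ (-(2 * b - m)) + 1 ^ (-(2 * b - m)))⁻¹ *
          ((1 - r) ^ a * ((1 : ℝ) ^ (-a) + 2 ^ (-a))⁻¹) *
          (‖q 1‖ / 2 / (2 * (1 - r)) ^ (2 + α))) := by
          rw [Real.mul_rpow two_pos.le h1r.le, show (-2 : ℝ) = a - (2 + α) by rw [hαa]; ring,
            Real.rpow_sub h1r, hk]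
          field_simp
      _ ≤ _ := by gcongr
  rw [hcongr, lintegral_ball_polar hGm]
  refine ENNReal.mul_eq_top.2 (Or.inl ⟨(ENNReal.ofReal_pos.2 hc).ne', ?_⟩)
  by_contra hcon
  have hle : ∫⁻ r in Set.Ioo (1 - δ) 1, ENNReal.ofReal k * ENNReal.ofReal ((1 - r) ^ (-1 : ℝ)) ≤
      ∫⁻ r in Set.Ioo (0 : ℝ) 1, ∫⁻ θ in Set.Ioo (-Real.pi) Real.pi,
        ENNReal.ofReal r * G (r * Complex.exp (θ * Complex.I)) := by
    refine le_trans (setLIntegral_mono' measurableSet_Ioo fun r hr => ?_)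
      (lintegral_mono_set (Set.Ioo_subset_Ioo_left (by linarith)))
    have h1r : 0 < 1 - r := by linarith [hr.2]
    have hrp : 0 < r := by linarith [hr.1]
    calc ENNReal.ofReal k * ENNReal.ofReal ((1 - r) ^ (-1 : ℝ))
        = ∫⁻ θ in Set.Ioo 0 (1 - r), ENNReal.ofReal (k * (1 - r) ^ (-2 : ℝ)) := by
          rw [setLIntegral_const, Real.volume_Ioo, ← ENNReal.ofReal_mul hk0.le,
            ← ENNReal.ofReal_mul (by positivity), sub_zero, mul_assoc k, ← Real.rpow_add_one h1r.ne']
          norm_num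
      _ ≤ ∫⁻ θ in Set.Ioo 0 (1 - r), ENNReal.ofReal r * G (r * Complex.exp (θ * Complex.I)) := by
          refine setLIntegral_mono' measurableSet_Ioo fun θ hθ => ?_
          rw [hG, ← ENNReal.ofReal_mul hrp.le]
          exact ENNReal.ofReal_le_ofReal (hbound r hr θ hθ)
      _ ≤ _ := lintegral_mono_set (Set.Ioo_subset_Ioo (by linarith [Real.pi_pos])
          (by linarith [Real.pi_gt_three]))
  have hfin := hle.trans_lt (lt_top_iff_ne_top.2 hcon)
  rw [lintegral_const_mul' _ _ ENNReal.ofReal_ne_top] at hfin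
  have hfin2 := ENNReal.lt_top_of_mul_ne_top_right hfin.ne (by simpa using hk0)
  have hsub := (Measure.measurePreserving_sub_left volume (1 : ℝ)).setLIntegral_comp_preimage_emb
    (MeasurableEquiv.subLeft (1 : ℝ)).measurableEmbedding
    (fun x => ENNReal.ofReal (x ^ (-1 : ℝ))) (Set.Ioo 0 δ)
  rw [Set.preimage_const_sub_Ioo, sub_zero] at hsub
  rw [hsub] at hfin2
  exact lt_irrefl _ (neg_one_lt_of_lintegral_Ioo_rpow_lt_top hδ0 hfin2)

end IsBergmanKernel

/-! ### The characterization of boundedness -/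

theorem IsBergmanKernel.isBoundedOnLp_iff {α β a b : ℝ} {m : ℕ} {q φ : ℂ → ℂ} {κ : ℂ → ℂ → ℂ}
    (H : IsBergmanKernel α β a b m q φ κ) (ha : -1 < a) (hb : -1 < b)
    (hα : -1 < α) (hβ : (m : ℝ) - 1 < β) (hqm : Measurable q)
    (hq : ContinuousOn q (Metric.closedBall 0 1)) (hq0 : q 0 ≠ 0) (hq1 : q 1 ≠ 0)
    {p : ℝ} (hp : 1 ≤ p) :
    IsBoundedOnLp (fun f z w => f w * κ z w) (fun f z => φ z * ∫ w, f w * κ z w ∂(mu a b))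
      (ENNReal.ofReal p) (mu a b) ↔
    a + 1 < p * (α + 1) ∧
        (p = 1 → (m : ℝ) - 2 < 2 * b ∧ 2 * b ≤ 2 * β - m) ∧
        (1 < p → p * m - 2 < 2 * b ∧ 2 * b < p * (2 * β + 2) - p * m - 2) := by
  obtain ⟨M, hM⟩ := (isCompact_closedBall (0 : ℂ) 1).exists_bound_of_continuousOn hq
  constructor
  · intro hT
    have h1 := H.exponent_gt_at_zero ha hb hα hq hq0 hp hT
    have h2 := H.exponent_lt_at_zero ha hb hα hq hq0 hp hT
    have h3 := H.exponent_lt_at_one ha hb hα hq hq0 hp hT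
    refine ⟨?_, fun hp1 => ⟨?_, ?_⟩, fun hp1 => ⟨h1, ?_⟩⟩
    · rcases h3 with h3 | ⟨rfl, h3⟩
      · linarith
      -- For $p=1$ the radial test leaves $\alpha=a$ open; concentration of mass at $w=1$ excludes
      -- it.
      · refine lt_of_le_of_ne (by linarith) fun heq => ?_
        rw [ENNReal.ofReal_one] at hT
        have hαa : α = a := by linarith
        exact (H.lintegral_mul_one_lt_top ha hb hαa hT).ne
          (H.lintegral_mul_one_eq_top ha hb hαa hqm hq hq1)
    · rw [hp1] at h1
      linarith
    · rw [hp1] at h2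
      rcases h2 with h2 | h2
      · linarith
      · linarith [h2.2]
    · rcases h2 with h2 | h2
      · linarith
      · exact absurd h2.1 hp1.ne'
  · rintro ⟨h1, h2, h3⟩
    rcases hp.eq_or_lt with rfl | hp1
    · exact H.isBoundedOnLp_one ha hb hM (by linarith) (h2 rfl).1 (h2 rfl).2
    · exact H.isBoundedOnLp_of_one_lt ha hb hα hβ hM hp1 h1 (h3 hp1).1 (h3 hp1).2

/-! ### The operators `A` and `B` -/

/-- Both kernels have the form $U(z\bar w)\,\omega(w)$, which reduces joint measurability and the
continuity requirements to functions of one variable. -/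
theorem isBergmanKernel_mul {α β a b : ℝ} {m : ℕ} {q φ U ω : ℂ → ℂ}
    (hφ : Measurable φ) (hφn : ∀ z, z ≠ 0 → ‖φ z‖ = ‖z‖ ^ (-(m : ℝ)))
    (hU : Measurable U) (hUc : ContinuousOn U (Metric.ball 0 1))
    (hUn : ∀ ξ ∈ Metric.ball (0 : ℂ) 1, ‖U ξ‖ = ‖q ξ‖ / ‖1 - ξ‖ ^ (2 + α))
    (hω : Measurable ω) (hωn : ∀ w ∈ Metric.ball (0 : ℂ) 1, w ≠ 0 →
      ‖ω w‖ = (1 - ‖w‖ ^ 2) ^ (α - a) * ‖w‖ ^ (2 * β - 2 * b - m))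
    (hω1 : α = a → ContinuousAt ω 1 ∧ ‖ω 1‖ = 1) :
    IsBergmanKernel α β a b m q φ (fun z w => U (z * conj w) * ω w) where
  measurable_left := hφ
  measurable_right := by
    have : Measurable fun x : ℂ × ℂ => x.1 * conj x.2 := by fun_prop
    exact (hU.comp this).mul (hω.comp measurable_snd)
  norm_left := hφn
  norm_right z hz w hw hw0 := by
    rw [norm_mul, hUn _ (mul_conj_mem_ball hz (Metric.ball_subset_closedBall hw)), hωn w hw hw0]
    ring
  continuousAt_zero w _ := by
    have h1 : ContinuousAt U (0 * conj w) := by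
      rw [zero_mul]
      exact hUc.continuousAt (Metric.ball_mem_nhds _ one_pos)
    have h2 : ContinuousAt (fun z : ℂ => z * conj w) 0 := by fun_prop
    exact (h1.comp (f := fun z : ℂ => z * conj w) h2).mul continuousAt_const
  continuousWithinAt_one h z hz := by
    have h1 : ContinuousAt U (z * conj 1) := hUc.continuousAt
      (Metric.isOpen_ball.mem_nhds (mul_conj_mem_ball hz (by simp)))
    have h2 : ContinuousAt (fun w : ℂ => z * conj w) 1 :=
      (continuous_const.mul Complex.continuous_conj).continuousAt
    exact ((h1.comp (f := fun w : ℂ => z * conj w) h2).mul (hω1 h).1).continuousWithinAt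
  norm_right_one h z hz := by
    rw [norm_mul, (hω1 h).2, mul_one, map_one, mul_one, hUn z hz]

theorem IsBoundedOnLp.congr {F F' : (ℂ → ℂ) → ℂ → ℂ → ℂ} {φ : ℂ → ℂ} {p : ℝ≥0∞} {μ : Measure ℂ}
    (h : ∀ f, ∀ᵐ z ∂μ, F f z =ᵐ[μ] F' f z)
    (hT : IsBoundedOnLp F (fun f z => φ z * ∫ w, F f z w ∂μ) p μ) :
    IsBoundedOnLp F' (fun f z => φ z * ∫ w, F' f z w ∂μ) p μ := by
  obtain ⟨C, hC⟩ := hT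
  refine ⟨C, fun f hf => ?_⟩
  obtain ⟨h1, h2, h3⟩ := hC f hf
  have hE : (fun z => φ z * ∫ w, F f z w ∂μ) =ᵐ[μ] fun z => φ z * ∫ w, F' f z w ∂μ := by
    filter_upwards [h f] with z hz
    rw [integral_congr_ae hz]
  refine ⟨?_, (memLp_congr_ae hE).1 h2, (eLpNorm_congr_ae hE) ▸ h3⟩
  filter_upwards [h f, h1] with z hz hz1
  exact hz1.congr hz

theorem isBoundedOnLp_congr {F F' : (ℂ → ℂ) → ℂ → ℂ → ℂ} {φ : ℂ → ℂ} {p : ℝ≥0∞} {μ : Measure ℂ}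
    (h : ∀ f, ∀ᵐ z ∂μ, F f z =ᵐ[μ] F' f z) :
    IsBoundedOnLp F (fun f z => φ z * ∫ w, F f z w ∂μ) p μ ↔
      IsBoundedOnLp F' (fun f z => φ z * ∫ w, F' f z w ∂μ) p μ :=
  ⟨fun hT => hT.congr h, fun hT => hT.congr fun f => (h f).mono fun _ hz => hz.symm⟩

section Operators

variable {α β a b : ℝ} {m : ℕ} {q : ℂ → ℂ}

theorem isBergmanKernel_opA (hqm : Measurable q) (hq : ContinuousOn q (Metric.ball 0 1)) :
    IsBergmanKernel α β a b m q (fun z => 1 / z ^ m) (fun z w =>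
      q (z * conj w) * ((1 - z * conj w) ^ ((2 + α : ℝ) : ℂ))⁻¹ *
        ((((1 - ‖w‖ ^ 2) ^ (α - a) : ℝ) : ℂ) * w ^ m *
          (((‖w‖ ^ (2 * m + 2 * b - 2 * β) : ℝ) : ℂ))⁻¹)) := by
  refine isBergmanKernel_mul (U := fun ξ => q ξ * ((1 - ξ) ^ ((2 + α : ℝ) : ℂ))⁻¹) (by fun_prop)
    (fun z hz => ?_) (by fun_prop) ?_ (fun ξ hξ => ?_) (by fun_prop) (fun w hw hw0 => ?_)
    fun h => ⟨?_, ?_⟩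
  · rw [norm_div, norm_one, norm_pow, Real.rpow_neg (norm_nonneg z), Real.rpow_natCast, one_div]
  -- Here $\operatorname{Re}(1-\xi)>0$, so the principal branch is continuous.
  · have hslit : ∀ ξ ∈ Metric.ball (0 : ℂ) 1, 1 - ξ ∈ Complex.slitPlane := fun ξ hξ => by
      refine Or.inl ?_
      have := (Complex.re_le_norm ξ).trans_lt (mem_ball_zero_iff.1 hξ)
      simpa using this
    refine hq.mul (ContinuousOn.inv₀ (ContinuousOn.cpow_const (by fun_prop) hslit) fun ξ hξ => ?_)
    have := Complex.slitPlane_ne_zero (hslit ξ hξ)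
    simp [Complex.cpow_eq_zero_iff, this]
  · rw [norm_mul, norm_inv, Complex.norm_cpow_real, div_eq_mul_inv]
  · have h1 := one_sub_norm_sq_pos hw
    have h2 : 0 < ‖w‖ := norm_pos_iff.2 hw0
    rw [norm_mul, norm_mul, norm_inv, norm_pow, Complex.norm_real, Complex.norm_real,
      Real.norm_eq_abs, Real.norm_eq_abs, abs_of_nonneg (by positivity),
      abs_of_nonneg (by positivity), ← Real.rpow_neg h2.le, ← Real.rpow_natCast ‖w‖ m, mul_assoc,
      ← Real.rpow_add h2]
    congr 2
    ring
  -- For $\alpha=a$ the factor $(1-|w|^2)^0$ is identically $1$, also on the circle, by the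
  -- convention $0^0=1$.
  · simp only [h, sub_self, Real.rpow_zero, Complex.ofReal_one, one_mul]
    refine (continuousAt_id.pow m).mul (ContinuousAt.inv₀ ?_ (by simp))
    exact Complex.continuous_ofReal.continuousAt.comp
      (continuous_norm.continuousAt.rpow_const (Or.inl (by simp)))
  · simp [h]

theorem isBergmanKernel_opB (hqm : Measurable q) (hq : ContinuousOn q (Metric.ball 0 1)) :
    IsBergmanKernel α β a b m q (fun z => 1 / ((‖z‖ ^ m : ℝ) : ℂ)) (fun z w =>
      ((‖q (z * conj w)‖ * (‖1 - z * conj w‖ ^ (2 + α))⁻¹ : ℝ) : ℂ) *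
        (((1 - ‖w‖ ^ 2) ^ (α - a) * ‖w‖ ^ (2 * β - 2 * b - m) : ℝ) : ℂ)) := by
  refine isBergmanKernel_mul (U := fun ξ => ((‖q ξ‖ * (‖1 - ξ‖ ^ (2 + α))⁻¹ : ℝ) : ℂ))
    (ω := fun w => (((1 - ‖w‖ ^ 2) ^ (α - a) * ‖w‖ ^ (2 * β - 2 * b - m) : ℝ) : ℂ))
    (by fun_prop)
    (fun z hz => ?_) (by fun_prop) ?_ (fun ξ hξ => ?_) (by fun_prop) (fun w hw hw0 => ?_)
    fun h => ⟨?_, ?_⟩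
  · rw [norm_div, norm_one, Complex.norm_real, norm_pow, norm_norm, Real.rpow_neg (norm_nonneg z),
      Real.rpow_natCast, one_div]
  · refine Complex.continuous_ofReal.comp_continuousOn (hq.norm.mul ?_)
    have hne : ∀ ξ ∈ Metric.ball (0 : ℂ) 1, ‖1 - ξ‖ ≠ 0 := fun ξ hξ => by
      have h1 := norm_sub_norm_le (1 : ℂ) ξ
      rw [norm_one] at h1
      have := mem_ball_zero_iff.1 hξ
      exact (by linarith : 0 < ‖1 - ξ‖).ne'
    refine ContinuousOn.inv₀ (ContinuousOn.rpow_const (by fun_prop) fun ξ hξ =>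
      Or.inl (hne ξ hξ)) fun ξ hξ => ?_
    exact (Real.rpow_pos_of_pos ((norm_nonneg _).lt_of_ne' (hne ξ hξ)) _).ne'
  · rw [Complex.norm_real, Real.norm_eq_abs, abs_of_nonneg (by positivity), div_eq_mul_inv]
  · have h1 := one_sub_norm_sq_pos hw
    rw [Complex.norm_real, Real.norm_eq_abs, abs_of_nonneg (by positivity)]
  · simp only [h, sub_self, Real.rpow_zero, one_mul]
    exact Complex.continuous_ofReal.continuousAt.comp
      (continuous_norm.continuousAt.rpow_const (Or.inl (by simp)))
  · simp [h]

theorem isBoundedOnLp_opA_iff (hq : ∀ ξ ∈ Metric.ball (0 : ℂ) 1, q ξ = Q α β ξ) (p : ℝ≥0∞) :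
    IsBoundedOnLp (integrandA α β a b m) (opA α β a b m) p (mu a b) ↔
      IsBoundedOnLp (fun f z w => f w * (q (z * conj w) *
        ((1 - z * conj w) ^ ((2 + α : ℝ) : ℂ))⁻¹ * ((((1 - ‖w‖ ^ 2) ^ (α - a) : ℝ) : ℂ) * w ^ m *
          (((‖w‖ ^ (2 * m + 2 * b - 2 * β) : ℝ) : ℂ))⁻¹)))
      (fun f z => 1 / z ^ m * ∫ w, f w * (q (z * conj w) *
        ((1 - z * conj w) ^ ((2 + α : ℝ) : ℂ))⁻¹ * ((((1 - ‖w‖ ^ 2) ^ (α - a) : ℝ) : ℂ) * w ^ m *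
          (((‖w‖ ^ (2 * m + 2 * b - 2 * β) : ℝ) : ℂ))⁻¹)) ∂(mu a b)) p (mu a b) := by
  refine isBoundedOnLp_congr (φ := fun z => 1 / z ^ m) fun f => ?_
  filter_upwards [ae_mu_mem a b] with z hz
  filter_upwards [ae_mu_mem a b] with w hw
  rw [integrandA, hq _ (mul_conj_mem_ball hz.1 (Metric.ball_subset_closedBall hw.1)), div_eq_mul_inv,
    mul_inv]
  ring

theorem isBoundedOnLp_opB_iff (hq : ∀ ξ ∈ Metric.ball (0 : ℂ) 1, q ξ = Q α β ξ) (p : ℝ≥0∞) :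
    IsBoundedOnLp (integrandB α β a b m) (opB α β a b m) p (mu a b) ↔
      IsBoundedOnLp (fun f z w => f w *
        (((‖q (z * conj w)‖ * (‖1 - z * conj w‖ ^ (2 + α))⁻¹ : ℝ) : ℂ) *
        (((1 - ‖w‖ ^ 2) ^ (α - a) * ‖w‖ ^ (2 * β - 2 * b - m) : ℝ) : ℂ)))
      (fun f z => 1 / ((‖z‖ ^ m : ℝ) : ℂ) * ∫ w, f w *
        (((‖q (z * conj w)‖ * (‖1 - z * conj w‖ ^ (2 + α))⁻¹ : ℝ) : ℂ) *
        (((1 - ‖w‖ ^ 2) ^ (α - a) * ‖w‖ ^ (2 * β - 2 * b - m) : ℝ) : ℂ)) ∂(mu a b))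
      p (mu a b) := by
  refine isBoundedOnLp_congr (φ := fun z => 1 / ((‖z‖ ^ m : ℝ) : ℂ)) fun f => ?_
  filter_upwards [ae_mu_mem a b] with z hz
  filter_upwards [ae_mu_mem a b] with w hw
  rw [integrandB, hq _ (mul_conj_mem_ball hz.1 (Metric.ball_subset_closedBall hw.1)), div_eq_mul_inv]
  push_cast
  ring

end Operators

end ModifiedBergman


/-! ### The equivalence of the three assertions -/

theorem mainTheorem1 (a b α β β₀ : ℝ) (m : ℕ) (ha : -1 < a) (hb : -1 < b) (hα : -1 < α)
    (hβ : -1 < β) (hβm : β = β₀ + m) (hβ₀ : β₀ ∈ ModifiedBergman.J α) (p : ℝ) (hp : 1 ≤ p) :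
    List.TFAE [
      ModifiedBergman.IsBoundedOnLp (ModifiedBergman.integrandA α β a b m)
        (ModifiedBergman.opA α β a b m) (ENNReal.ofReal p) (ModifiedBergman.mu a b),
      ModifiedBergman.IsBoundedOnLp (ModifiedBergman.integrandB α β a b m)
        (ModifiedBergman.opB α β a b m) (ENNReal.ofReal p) (ModifiedBergman.mu a b),
      a + 1 < p * (α + 1) ∧
        (p = 1 → (m : ℝ) - 2 < 2 * b ∧ 2 * b ≤ 2 * β - m) ∧
        (1 < p → p * m - 2 < 2 * b ∧ 2 * b < p * (2 * β + 2) - p * m - 2)] := by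
  open ModifiedBergman in
  obtain ⟨hQ, hQ0, hQ1⟩ := Q_properties hα hβ hβm hβ₀.1
  classical
  -- Continuity of $Q$ is known only on the closed disk; cutting off outside gives a globally
  -- measurable function, and the operators evaluate it only at $z\bar w$ in the open disk.
  set q : ℂ → ℂ := (Metric.closedBall (0 : ℂ) 1).piecewise (Q α β) 0 with hq
  have hqQ : ∀ ξ ∈ Metric.closedBall (0 : ℂ) 1, q ξ = Q α β ξ := fun ξ hξ =>
    Set.piecewise_eq_of_mem _ _ _ hξ
  have hqc : ContinuousOn q (Metric.closedBall 0 1) := hQ.congr hqQ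
  have hqm : Measurable q :=
    hQ.measurable_piecewise continuousOn_const Metric.isClosed_closedBall.measurableSet
  have hqb := fun ξ (hξ : ξ ∈ Metric.ball (0 : ℂ) 1) => hqQ ξ (Metric.ball_subset_closedBall hξ)
  have hq0 : q 0 ≠ 0 := by rwa [hqQ 0 (by simp)]
  have hq1 : q 1 ≠ 0 := by rwa [hqQ 1 (by simp)]
  have hm : (m : ℝ) - 1 < β := by linarith [hβ₀.1.1]
  have hA := (isBoundedOnLp_opA_iff (a := a) (b := b) (m := m) hqb (ENNReal.ofReal p)).trans
    ((isBergmanKernel_opA hqm (hqc.mono Metric.ball_subset_closedBall)).isBoundedOnLp_iff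
      ha hb hα hm hqm hqc hq0 hq1 hp)
  have hB := (isBoundedOnLp_opB_iff (a := a) (b := b) (m := m) hqb (ENNReal.ofReal p)).trans
    ((isBergmanKernel_opB hqm (hqc.mono Metric.ball_subset_closedBall)).isBoundedOnLp_iff
      ha hb hα hm hqm hqc hq0 hq1 hp)
  tfae_have 1 ↔ 3 := hA
  tfae_have 2 ↔ 3 := hB
  tfae_finish
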